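/- **Definitions.** A *$\mathcal K$-adjunction* is a category $\mathcal A$ with an endofunctor $F$ and natural transformations $\varphi_a:FFa\to a$, $\gamma_a:a\to FFa$ such that $F\varphi_a\circ\gamma_{Fa}=\varphi_{Fa}\circ F\gamma_a=\mathbf 1_{Fa}$ and $F(\varphi_a\circ\gamma_a)=\varphi_{Fa}\circ\gamma_{Fa}$. $\mathcal K_c$ is the category of the free $\mathcal K$-adjunction generated by one object $0$. Its objects $0,F0,FF0,\dots$ are identified with the natural numbers. Its arrow-terms are built from $\mathbf 1_n:n\to n$, $\varphi_n:n+2\to n$ and $\gamma_n:n\to n+2$ ($n\ge 0$) by the rules: $f:m\to n$ gives $Ff:m+1\to n+1$, and $f:m\to n$, $g:n\to k$ give $g\circ f:m\to k$. Its arrows are the classes of arrow-terms modulo the smallest equivalence relation that is a congruence for $F$ and $\circ$ and contains the equations of $\mathcal K$-adjunctions (category, functor and naturality equations and the equations displayed above). Let $\mathcal F$ be a subfield of $\mathbf C$. $\mathbf{Mat}_{\mathcal F}$ is the category whose objects are the natural numbers, whose arrows $m\to n$ are the $n\times m$ matrices over $\mathcal F$, and whose composition is matrix multiplication. For $p\ge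 1$ let $\otimes$ denote the Kronecker product and $E_p$ the $1\times p^2$ matrix with $E_p(1,(i-1)p+j)=\delta(i,j)$ for $1\le i,j\le p$. Then $\mathbf{Mat}_{\mathcal F}$ is a $\mathcal K$-adjunction with the functor $p\otimes$ given by $m\mapsto pm$, $B\mapsto \mathbf 1_p\otimes B$, with $\varphi_m=E_p\otimes\mathbf 1_m$, and with $\gamma_m$ the transpose of $\varphi_m$. The functor $H_p:\mathcal K_c\to\mathbf{Mat}_{\mathcal F}$ is the one that preserves this structure and sends $0$ to $1$: thus $H_p(m)=p^m$, $H_p(\varphi_m)=\varphi_{p^m}$, $H_p(\gamma_m)=\gamma_{p^m}$, and $H_p(Ff)=\mathbf 1_p\otimes H_p(f)$. For $n\ge 0$ the Temperley–Lieb monoid $\mathcal K_n$ is the monoid presented by generators $h_1,\dots,h_{n-1}$ and $c$ (only $c$ if $n\le 1$) and the relations $h_ih_j=h_jh_i$ for $i+2\le j$; $h_ih_{i\pm1}h_i=h_i$; $h_ic=ch_i$; $h_ih_i=ch_i$. **Theorem.** Let $\mathcal F$ be a subfield of $\mathbf C$ and let $p\ge 2$. 1. (Faithfulness of $H_p$.)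 If $f,g$ are arrow-terms of the same type and $H_p(f)=H_p(g)$, then $f=g$ in $\mathcal K_c$. Moreover, $H_p$ is one-one on objects and one-one on arrows (arrows of arbitrary types). 2. $\mathcal K_c$ is isomorphically represented in matrices: there is a subcategory $\mathcal S$ of $\mathbf{Mat}_{\mathcal F}$ such that $H_p$ is the composite of an isomorphism of categories $\mathcal K_c\to\mathcal S$ with the inclusion $\mathcal S\to\mathbf{Mat}_{\mathcal F}$. 3. For every $n\ge 0$ there is a one-one monoid homomorphism $\rho$ from $\mathcal K_n$ into the multiplicative monoid of $p^n\times p^n$ matrices over $\mathcal F$ with $$\rho(h_i)=\mathbf 1_{p^{n-i-1}}\otimes(E_p^{\mathsf T}E_p)\otimes\mathbf 1_{p^{i-1}}\quad(1\le i\le n-1),\qquad \rho(c)=p\,\mathbf 1_{p^n}$$ (the restriction to $\mathcal K_n$ of the orthogonal-group case of Brauer's representation), and its image is exactly $\{H_p(f)\mid f:n\to n\text{ an arrow of }\mathcal K_c\}$. So $\mathcal K_n$ is isomorphic to this monoid of $p^n\times p^n$ matrices. -/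

import Mathlib

open CategoryTheory

namespace SelfAdjoint

universe v u w

/-! ### Self-adjunctions -/

/-- A `K`-adjunction on a category: an endofunctor `F` that is both left and right adjoint to
itself, with counit `φ` and unit `γ`, such that moreover `F (φ ∘ γ) = φ F ∘ γ F`. -/
structure KAdjunction (C : Type u) [Category.{v} C] where
  F : C ⥤ C
  φ : F ⋙ F ⟶ 𝟭 C
  γ : 𝟭 C ⟶ F ⋙ F
  triangle_left : ∀ a : C, γ.app (F.obj a) ≫ F.map (φ.app a) = 𝟙 (F.obj a)
  triangle_right : ∀ a : C, F.map (γ.app a) ≫ φ.app (F.obj a) = 𝟙 (F.obj a)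
  circle : ∀ a : C, F.map (γ.app a ≫ φ.app a) = γ.app (F.obj a) ≫ φ.app (F.obj a)

/-! ### The free `K`-adjunction generated by one object -/

/-- Arrow-terms, `ArrowTerm m n` being the terms of type `m → n`. The natural number `n` stands
for the object `F (F (⋯ 0))`, with `n` occurrences of `F`. -/
inductive ArrowTerm : ℕ → ℕ → Type
  | one (n : ℕ) : ArrowTerm n n
  | phi (n : ℕ) : ArrowTerm (n + 2) n
  | gam (n : ℕ) : ArrowTerm n (n + 2)
  | F {m n : ℕ} (f : ArrowTerm m n) : ArrowTerm (m + 1) (n + 1)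
  | comp {m n k : ℕ} (g : ArrowTerm n k) (f : ArrowTerm m n) : ArrowTerm m k

/-- Equality of arrow-terms in the free `K`-adjunction: the smallest equivalence relation that is
a congruence for `F` and composition and satisfies the `K`-equations. -/
inductive KEq : {m n : ℕ} → ArrowTerm m n → ArrowTerm m n → Prop
  | refl {m n : ℕ} (f : ArrowTerm m n) : KEq f f
  | symm {m n : ℕ} {f g : ArrowTerm m n} : KEq f g → KEq g f
  | trans {m n : ℕ} {f g h : ArrowTerm m n} : KEq f g → KEq g h → KEq f h
  | congr_F {m n : ℕ} {f g : ArrowTerm m n} : KEq f g → KEq f.F g.F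
  | congr_comp {m n k : ℕ} {f₁ f₂ : ArrowTerm m n} {g₁ g₂ : ArrowTerm n k} :
      KEq f₁ f₂ → KEq g₁ g₂ → KEq (g₁.comp f₁) (g₂.comp f₂)
  | comp_one {m n : ℕ} (f : ArrowTerm m n) : KEq (f.comp (.one m)) f
  | one_comp {m n : ℕ} (f : ArrowTerm m n) : KEq ((ArrowTerm.one n).comp f) f
  | assoc {m n k l : ℕ} (f : ArrowTerm m n) (g : ArrowTerm n k) (h : ArrowTerm k l) :
      KEq (h.comp (g.comp f)) ((h.comp g).comp f)
  | F_one (n : ℕ) : KEq (ArrowTerm.one n).F (.one (n + 1))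
  | F_comp {m n k : ℕ} (g : ArrowTerm n k) (f : ArrowTerm m n) :
      KEq (g.comp f).F (g.F.comp f.F)
  | nat_phi {m n : ℕ} (f : ArrowTerm m n) :
      KEq (f.comp (.phi m)) ((ArrowTerm.phi n).comp f.F.F)
  | nat_gam {m n : ℕ} (f : ArrowTerm m n) :
      KEq (f.F.F.comp (.gam m)) ((ArrowTerm.gam n).comp f)
  | triangle_left (n : ℕ) :
      KEq ((ArrowTerm.phi n).F.comp (.gam (n + 1))) (.one (n + 1))
  | triangle_right (n : ℕ) :
      KEq ((ArrowTerm.phi (n + 1)).comp (ArrowTerm.gam n).F) (.one (n + 1))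
  | circle (n : ℕ) :
      KEq ((ArrowTerm.phi n).comp (.gam n)).F ((ArrowTerm.phi (n + 1)).comp (.gam (n + 1)))

/-- The setoid of `K`-equality on arrow-terms of a given type. -/
instance arrowSetoid (m n : ℕ) : Setoid (ArrowTerm m n) where
  r := KEq
  iseqv := ⟨KEq.refl, KEq.symm, KEq.trans⟩

/-- Objects of the free `K`-adjunction category `K_c`: one for each natural number. -/
structure KC where
  deg : ℕ

namespace KC

/-- Arrows of `K_c` are equivalence classes of arrow-terms. -/
instance : Category KC where
  Hom a b := Quotient (arrowSetoid a.deg b.deg)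
  id a := Quotient.mk _ (.one a.deg)
  comp f g := Quotient.map₂ (fun f g => ArrowTerm.comp g f)
    (fun _ _ hf _ _ hg => KEq.congr_comp hf hg) f g
  id_comp f := Quotient.inductionOn f fun f => Quotient.sound (KEq.comp_one f)
  comp_id f := Quotient.inductionOn f fun f => Quotient.sound (KEq.one_comp f)
  assoc f g h := Quotient.inductionOn₃ f g h fun f g h => Quotient.sound (KEq.assoc f g h)

/-- The arrow of `K_c` named by an arrow-term. -/
def arrow {m n : ℕ} (f : ArrowTerm m n) : (KC.mk m) ⟶ (KC.mk n) :=
  Quotient.mk (arrowSetoid m n) f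

/-- The `K`-adjunction carried by `K_c`. -/
def adj : KAdjunction KC where
  F :=
    { obj a := ⟨a.deg + 1⟩
      map f := Quotient.map ArrowTerm.F (fun _ _ h => KEq.congr_F h) f
      map_id a := Quotient.sound (KEq.F_one a.deg)
      map_comp f g := Quotient.inductionOn₂ f g fun f g => Quotient.sound (KEq.F_comp g f) }
  φ :=
    { app a := arrow (.phi a.deg)
      naturality _ _ f := Quotient.inductionOn f fun f =>
        Quotient.sound (KEq.symm (KEq.nat_phi f)) }
  γ :=
    { app a := arrow (.gam a.deg)
      naturality _ _ f := Quotient.inductionOn f fun f =>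
        Quotient.sound (KEq.symm (KEq.nat_gam f)) }
  triangle_left a := Quotient.sound (KEq.triangle_left a.deg)
  triangle_right a := Quotient.sound (KEq.triangle_right a.deg)
  circle a := Quotient.sound (KEq.circle a.deg)

section Lift

variable {C : Type u} [Category.{v} C] (A : KAdjunction C) (x : C)

/-- Interpretation of the objects of `K_c` in a `K`-adjunction: `0 ↦ x` and `n + 1 ↦ F n`. -/
def liftObj : ℕ → C
  | 0 => x
  | n + 1 => A.F.obj (liftObj n)

/-- Interpretation of the arrow-terms in a `K`-adjunction. -/
def liftTerm : {m n : ℕ} → ArrowTerm m n → (liftObj A x m ⟶ liftObj A x n)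
  | _, _, .one n => 𝟙 (liftObj A x n)
  | _, _, .phi n => A.φ.app (liftObj A x n)
  | _, _, .gam n => A.γ.app (liftObj A x n)
  | _, _, .F f => A.F.map (liftTerm f)
  | _, _, .comp g f => liftTerm f ≫ liftTerm g

theorem liftTerm_eq {m n : ℕ} {f g : ArrowTerm m n} (h : KEq f g) :
    liftTerm A x f = liftTerm A x g := by
  induction h with
  | refl f => rfl
  | symm _ ih => exact ih.symm
  | trans _ _ ih₁ ih₂ => exact ih₁.trans ih₂
  | congr_F _ ih => exact congrArg A.F.map ih
  | congr_comp _ _ ih₁ ih₂ => simp only [liftTerm, ih₁, ih₂]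
  | comp_one f => simp [liftTerm]
  | one_comp f => simp [liftTerm]
  | assoc f g h => simp [liftTerm]
  | F_one n => exact A.F.map_id _
  | F_comp g f => exact A.F.map_comp _ _
  | nat_phi f => exact (A.φ.naturality (liftTerm A x f)).symm
  | nat_gam f => exact (A.γ.naturality (liftTerm A x f)).symm
  | triangle_left n => exact A.triangle_left _
  | triangle_right n => exact A.triangle_right _
  | circle n => exact A.circle _

/-- The functor out of the free `K`-adjunction category that sends the generating object to `x`
and preserves the structure of `K`-adjunctions. -/
def lift : KC ⥤ C where
  obj a := liftObj A x a.deg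
  map f := Quotient.lift (fun t => liftTerm A x t) (fun _ _ h => liftTerm_eq A x h) f
  map_id _ := rfl
  map_comp f g := Quotient.inductionOn₂ f g fun _ _ => rfl

end Lift

end KC

/-! ### The category of matrices -/

/-- Objects of the category of matrices over `R`: natural numbers. -/
structure MatCat (R : Type u) where
  dim : ℕ

namespace MatCat

/-- An arrow `m → n` is an `n × m` matrix, and composition is the matrix product. -/
instance (R : Type u) [CommRing R] : Category (MatCat R) where
  Hom m n := Matrix (Fin n.dim) (Fin m.dim) R
  id m := (1 : Matrix (Fin m.dim) (Fin m.dim) R)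
  comp f g := HMul.hMul (α := Matrix _ _ R) (β := Matrix _ _ R) g f
  id_comp f := Matrix.mul_one f
  comp_id f := Matrix.one_mul f
  assoc f g h := (Matrix.mul_assoc h g f).symm

end MatCat

section Kronecker

variable {R : Type u} [CommRing R]

set_option linter.unusedSectionVars false

/-- The Kronecker product of matrices with rows and columns numbered consecutively: the pair
`(i, j)` has number `i * n + j`, where `n` is the number of values of `j`. -/
def kron {a b c d : ℕ} (A : Matrix (Fin a) (Fin b) R) (B : Matrix (Fin c) (Fin d) R) :
    Matrix (Fin (a * c)) (Fin (b * d)) R :=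
  (Matrix.kroneckerMap (· * ·) A B).submatrix finProdFinEquiv.symm finProdFinEquiv.symm

/-- The row matrix `E_p`, whose entry in column `i * p + j` is the Kronecker delta `δ(i, j)`. -/
def rowE (R : Type u) [CommRing R] (p : ℕ) : Matrix (Fin 1) (Fin (p * p)) R :=
  Matrix.of fun _ x => if (finProdFinEquiv.symm x).1 = (finProdFinEquiv.symm x).2 then 1 else 0

/-- The `m × p²m` matrix `φ_m = E_p ⊗ 1_m`. -/
def phiMat (R : Type u) [CommRing R] (p m : ℕ) : Matrix (Fin m) (Fin (p * (p * m))) R :=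
  Matrix.reindex (finCongr (Nat.one_mul m)) (finCongr (Nat.mul_assoc p p m))
    (kron (rowE R p) (1 : Matrix (Fin m) (Fin m) R))

theorem kron_apply {a b c d : ℕ} (A : Matrix (Fin a) (Fin b) R) (B : Matrix (Fin c) (Fin d) R)
    (i : Fin a) (j : Fin c) (k : Fin b) (l : Fin d) :
    kron A B (finProdFinEquiv (i, j)) (finProdFinEquiv (k, l)) = A i k * B j l := by
  simp [kron]

theorem phiMat_apply (p m : ℕ) (i j : Fin m) (a b : Fin p) :
    phiMat R p m i (finProdFinEquiv (a, finProdFinEquiv (b, j))) =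
      if a = b ∧ i = j then 1 else 0 := by
  have h1 : (finCongr (Nat.one_mul m)).symm i = finProdFinEquiv ((0 : Fin 1), i) := by
    ext; simp
  have h2 : (finCongr (Nat.mul_assoc p p m)).symm (finProdFinEquiv (a, finProdFinEquiv (b, j)))
      = finProdFinEquiv (finProdFinEquiv (a, b), j) := by
    ext; simp; ring
  rw [phiMat, Matrix.reindex_apply, Matrix.submatrix_apply, h1, h2, kron_apply]
  simp only [rowE, Matrix.of_apply, Equiv.symm_apply_apply, Matrix.one_apply]
  split_ifs <;> simp_all

theorem ext_pair {a b c : ℕ} {A B : Matrix (Fin (a * b)) (Fin c) R}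
    (h : ∀ i j k, A (finProdFinEquiv (i, j)) k = B (finProdFinEquiv (i, j)) k) : A = B := by
  ext x k
  obtain ⟨⟨i, j⟩, rfl⟩ := finProdFinEquiv.surjective x
  exact h i j k

theorem sum_pair {a b : ℕ} (f : Fin (a * b) → R) :
    ∑ x, f x = ∑ i, ∑ j, f (finProdFinEquiv (i, j)) := by
  rw [← finProdFinEquiv.sum_comp, Fintype.sum_prod_type]

theorem kron_one_one (p m : ℕ) :
    kron (1 : Matrix (Fin p) (Fin p) R) (1 : Matrix (Fin m) (Fin m) R) = 1 := by
  have h := Matrix.one_kronecker_one (α := R) (m := Fin p) (n := Fin m)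
  unfold kron
  rw [h, Matrix.submatrix_one_equiv]

theorem kron_mul {a b c a' b' c' : ℕ} (A : Matrix (Fin a) (Fin b) R) (B : Matrix (Fin b) (Fin c) R)
    (A' : Matrix (Fin a') (Fin b') R) (B' : Matrix (Fin b') (Fin c') R) :
    kron (A * B) (A' * B') = kron A A' * kron B B' := by
  have h := Matrix.mul_kronecker_mul A B A' B'
  unfold kron
  rw [h, Matrix.submatrix_mul_equiv]

theorem kron_transpose {a b c d : ℕ} (A : Matrix (Fin a) (Fin b) R)
    (B : Matrix (Fin c) (Fin d) R) : (kron A B).transpose = kron A.transpose B.transpose := rfl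

theorem phiMat_nat (p : ℕ) {m n : ℕ} (f : Matrix (Fin n) (Fin m) R) :
    f * phiMat R p m = phiMat R p n *
      kron (1 : Matrix (Fin p) (Fin p) R) (kron (1 : Matrix (Fin p) (Fin p) R) f) := by
  ext i x
  obtain ⟨⟨a, y⟩, rfl⟩ := finProdFinEquiv.surjective x
  obtain ⟨⟨b, j⟩, rfl⟩ := finProdFinEquiv.surjective y
  simp only [Matrix.mul_apply, sum_pair, phiMat_apply, kron_apply, Matrix.one_apply]
  by_cases hab : a = b
  · subst hab
    simp [ite_and, Finset.sum_ite_eq]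
  · simp [hab, ite_and]

theorem phiMat_triangle (p m : ℕ) :
    kron (1 : Matrix (Fin p) (Fin p) R) (phiMat R p m) * (phiMat R p (p * m)).transpose = 1 := by
  refine ext_pair fun a i x => ?_
  obtain ⟨⟨b, j⟩, rfl⟩ := finProdFinEquiv.surjective x
  simp only [Matrix.mul_apply, sum_pair, phiMat_apply, kron_apply, Matrix.one_apply,
    Matrix.transpose_apply, EmbeddingLike.apply_eq_iff_eq, Prod.mk.injEq]
  simp [ite_and]
  split_ifs <;> rfl

theorem phiMat_circle (p m : ℕ) :
    phiMat R p m * (phiMat R p m).transpose = (p : R) • (1 : Matrix (Fin m) (Fin m) R) := by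
  ext i j
  simp only [Matrix.mul_apply, sum_pair, phiMat_apply, Matrix.transpose_apply, Matrix.smul_apply,
    Matrix.one_apply]
  simp [ite_and]

theorem kron_one_smul (p m : ℕ) (r : R) :
    kron (1 : Matrix (Fin p) (Fin p) R) (r • (1 : Matrix (Fin m) (Fin m) R)) = r • 1 := by
  rw [← kron_one_one]
  have h := Matrix.kronecker_smul r (1 : Matrix (Fin p) (Fin p) R) (1 : Matrix (Fin m) (Fin m) R)
  unfold kron
  rw [h]
  rfl

end Kronecker

namespace MatCat

/-- The `K`-adjunction on the category of matrices in which the endofunctor is `p ⊗`, i.e.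
`m ↦ p * m` and `B ↦ 1_p ⊗ B`, with counit `φ_m = E_p ⊗ 1_m` and unit the transpose of `φ_m`. -/
def adj (R : Type u) [CommRing R] (p : ℕ) : KAdjunction (MatCat R) where
  F :=
    { obj m := ⟨p * m.dim⟩
      map B := kron (1 : Matrix (Fin p) (Fin p) R) B
      map_id m := kron_one_one p m.dim
      map_comp f g := by
        have h := kron_mul (1 : Matrix (Fin p) (Fin p) R) (1 : Matrix (Fin p) (Fin p) R) g f
        rw [Matrix.one_mul] at h
        exact h }
  φ :=
    { app m := phiMat R p m.dim
      naturality _ _ f := (phiMat_nat p f).symm }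
  γ :=
    { app m := (phiMat R p m.dim).transpose
      naturality m n f := by
        have h := congrArg Matrix.transpose (phiMat_nat p (Matrix.transpose f))
        rw [Matrix.transpose_mul, Matrix.transpose_mul, kron_transpose, kron_transpose,
          Matrix.transpose_transpose, Matrix.transpose_one] at h
        exact h }
  triangle_left m := phiMat_triangle p m.dim
  triangle_right m := by
    have h := congrArg Matrix.transpose (phiMat_triangle (R := R) p m.dim)
    rw [Matrix.transpose_mul, kron_transpose, Matrix.transpose_transpose, Matrix.transpose_one,
      Matrix.transpose_one] at h
    exact h
  circle m := by
    have h : kron (1 : Matrix (Fin p) (Fin p) R)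
        (phiMat R p m.dim * (phiMat R p m.dim).transpose) =
        phiMat R p (p * m.dim) * (phiMat R p (p * m.dim)).transpose := by
      rw [phiMat_circle, phiMat_circle, kron_one_smul]
    exact h

end MatCat

/-- The functor `H_p` from the free `K`-adjunction category to the category of matrices: the
functor of `K`-adjunctions, with `p ⊗` on matrices, that sends the generating object to `1`. -/
def H (R : Type u) [CommRing R] (p : ℕ) : KC ⥤ MatCat R :=
  KC.lift (MatCat.adj R p) ⟨1⟩

theorem H_obj_dim (R : Type u) [CommRing R] (p n : ℕ) : ((H R p).obj ⟨n⟩).dim = p ^ n := by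
  induction n with
  | zero => rfl
  | succ n ih => rw [pow_succ', ← ih]; rfl

/-- The image `H_p(f)` of an endomorphism `f : n → n`, as a `p^n × p^n` matrix. -/
def endMatrix (R : Type u) [CommRing R] (p n : ℕ) (f : KC.mk n ⟶ KC.mk n) :
    Matrix (Fin (p ^ n)) (Fin (p ^ n)) R :=
  Matrix.reindex (finCongr (H_obj_dim R p n)) (finCongr (H_obj_dim R p n)) ((H R p).map f)

/-! ### Subcategories -/

/-- A subcategory of `C`: a class of objects and a class of arrows between them, containing the
identities of its objects and closed under composition. -/
structure Subcat (C : Type u) [Category.{v} C] where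
  objs : Set C
  homs : ∀ X Y : C, Set (X ⟶ Y)
  id_mem : ∀ X ∈ objs, 𝟙 X ∈ homs X X
  comp_mem : ∀ (X Y Z : C) (f : X ⟶ Y) (g : Y ⟶ Z), X ∈ objs → Y ∈ objs → Z ∈ objs →
    f ∈ homs X Y → g ∈ homs Y Z → f ≫ g ∈ homs X Z

/-- Objects of a subcategory. -/
structure Subcat.Obj {C : Type u} [Category.{v} C] (S : Subcat C) where
  val : C
  mem : val ∈ S.objs

instance {C : Type u} [Category.{v} C] (S : Subcat C) : Category S.Obj where
  Hom X Y := {f : X.val ⟶ Y.val // f ∈ S.homs X.val Y.val}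
  id X := ⟨𝟙 X.val, S.id_mem _ X.mem⟩
  comp {X Y Z} f g := ⟨f.1 ≫ g.1, S.comp_mem _ _ _ _ _ X.mem Y.mem Z.mem f.2 g.2⟩
  id_comp f := Subtype.ext (Category.id_comp f.1)
  comp_id f := Subtype.ext (Category.comp_id f.1)
  assoc f g h := Subtype.ext (Category.assoc f.1 g.1 h.1)

/-- The inclusion functor of a subcategory. -/
def Subcat.incl {C : Type u} [Category.{v} C] (S : Subcat C) : S.Obj ⥤ C where
  obj X := X.val
  map f := f.1

/-- A functor is an isomorphism of categories if it is bijective on objects and on arrows. -/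
def IsCategoryIso {C : Type u} [Category.{v} C] {D : Type w} [Category.{v} D] (G : C ⥤ D) : Prop :=
  Function.Bijective G.obj ∧
    ∀ X Y : C, Function.Bijective (fun f : X ⟶ Y => G.map f)

/-! ### The monoids `K_n` -/

/-- Generators of the monoid `K_n`: the diapsides `h_1, …, h_{n-1}` and the circle `c`. The
diapsis `h_i` is `KGen.h` of `i - 1`. -/
inductive KGen (n : ℕ)
  | h (i : Fin (n - 1))
  | c

open FreeMonoid in
/-- The defining equations of the monoid `K_n`. -/
inductive KRel (n : ℕ) : FreeMonoid (KGen n) → FreeMonoid (KGen n) → Prop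
  | h_comm (i j : Fin (n - 1)) (hij : (i : ℕ) + 2 ≤ j) :
      KRel n (of (.h i) * of (.h j)) (of (.h j) * of (.h i))
  | h_succ (i j : Fin (n - 1)) (hij : (j : ℕ) = i + 1) :
      KRel n (of (.h i) * of (.h j) * of (.h i)) (of (.h i))
  | h_pred (i j : Fin (n - 1)) (hij : (i : ℕ) = j + 1) :
      KRel n (of (.h i) * of (.h j) * of (.h i)) (of (.h i))
  | h_circle (i : Fin (n - 1)) :
      KRel n (of (.h i) * of .c) (of .c * of (.h i))
  | h_sq (i : Fin (n - 1)) :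
      KRel n (of (.h i) * of (.h i)) (of .c * of (.h i))

/-- The (multiplicative) Temperley–Lieb monoid `K_n`. -/
abbrev KMon (n : ℕ) : Type := PresentedMonoid (KRel n)

theorem diapsis_size (p n : ℕ) (k : Fin (n - 1)) :
    p ^ (n - 2 - (k : ℕ)) * (p * p * p ^ (k : ℕ)) = p ^ n := by
  have h : n = (n - 2 - (k : ℕ)) + 2 + k := by have := k.2; omega
  conv_rhs => rw [h]
  ring

/-- The `p^n × p^n` matrix `1_{p^(n-i-1)} ⊗ (E_pᵀ E_p) ⊗ 1_{p^(i-1)}` for `i = k + 1`. -/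
def diapsisMatrix (R : Type u) [CommRing R] (p n : ℕ) (k : Fin (n - 1)) :
    Matrix (Fin (p ^ n)) (Fin (p ^ n)) R :=
  Matrix.reindex (finCongr (diapsis_size p n k)) (finCongr (diapsis_size p n k))
    (kron (1 : Matrix (Fin (p ^ (n - 2 - (k : ℕ)))) (Fin (p ^ (n - 2 - (k : ℕ)))) R)
      (kron ((rowE R p).transpose * rowE R p)
        (1 : Matrix (Fin (p ^ (k : ℕ))) (Fin (p ^ (k : ℕ))) R)))

end SelfAdjoint

/-! Endomorphisms come first. Every endomorphism of `n` in K_c is a product of diapsides and circles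
(`KC.isWord`), so the monoid K_n maps onto End(n), and from there by H_p to matrices. It is enough
that the composite `rep` is one-one: its first factor being onto, H_p is then one-one on End(n)
(`endMatrix_injective`).

Each element of K_n is c^k times a Jones normal form (`exists_jones`), a product of runs h_a h_{a+1}
⋯ h_b whose first letters and last letters both strictly decrease. A p^n × p^n matrix acts on
functions of sequences with values in `Fin p`, through the base-p digits of its indices; a diapsis
then acts by an operator independent of n. A run demands x_a = x_{a+1}, deletes this pair, and
inserts a pair of equal entries at b, b + 1, summing over their value (`run_diapOp`). The action of
a normal form therefore betrays its leading run: b from the coordinates on which it acts as the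
identity, a from the equalities of coordinates that it imposes. That run can be cancelled, and
induction recovers the whole word and k (`IsJones.unique`). This needs two distinct symbols and
distinct powers of p, hence p ≥ 2. The coefficients are natural numbers, so sums cannot cancel;
characteristic zero carries the conclusion to the field.

For other types, the self-adjunction bends one strand, matching arrows m → n + 1 with arrows m + 1 →
n compatibly with H_p. Arrows m → n with m + n = 2N are thus reduced to endomorphisms of N, and
there are none with m + n odd. Finally, a functor one-one on objects and arrows is an isomorphism
onto its image. -/

namespace SelfAdjoint

/-! ### Diapsides, circles and words in K_c -/

namespace KC

/-- Arrows of `K_c` from `m` to `n`. -/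
abbrev Arr (m n : ℕ) : Type := KC.mk m ⟶ KC.mk n

/-- The action on arrows of the endofunctor of `K_c`. -/
def up {m n : ℕ} (f : Arr m n) : Arr (m + 1) (n + 1) := adj.F.map f

/-- The counit `φ_n`. -/
def cap (n : ℕ) : Arr (n + 2) n := adj.φ.app ⟨n⟩

/-- The unit `γ_n`. -/
def cup (n : ℕ) : Arr n (n + 2) := adj.γ.app ⟨n⟩

/-- The circle on `n`. -/
def circ (n : ℕ) : Arr n n := cup n ≫ cap n

/-- The diapsis joining the strands `i` and `i + 1`. -/
def diap : (n : ℕ) → ℕ → Arr n n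
  | 0, _ => 𝟙 _
  | 1, _ => 𝟙 _
  | n + 2, i => if i = n then cap n ≫ cup n else up (diap (n + 1) i)

variable {k l m n : ℕ}

theorem up_id (n : ℕ) : up (𝟙 (KC.mk n)) = 𝟙 (KC.mk (n + 1)) := adj.F.map_id _

theorem up_comp (f : Arr k m) (g : Arr m n) : up (f ≫ g) = up f ≫ up g := adj.F.map_comp _ _

theorem up_up_cap (f : Arr m n) : up (up f) ≫ cap n = cap m ≫ f := adj.φ.naturality f

theorem cup_up_up (f : Arr m n) : cup m ≫ up (up f) = f ≫ cup n := (adj.γ.naturality f).symm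

theorem up_up_cap_assoc (f : Arr m n) (g : Arr n k) :
    up (up f) ≫ cap n ≫ g = cap m ≫ f ≫ g := by
  rw [← Category.assoc, up_up_cap, Category.assoc]

theorem cup_up_up_assoc (f : Arr m n) (g : Arr (n + 2) k) :
    cup m ≫ up (up f) ≫ g = f ≫ cup n ≫ g := by
  rw [← Category.assoc, cup_up_up, Category.assoc]

theorem cup_up_cap (n : ℕ) : cup (n + 1) ≫ up (cap n) = 𝟙 (KC.mk (n + 1)) :=
  adj.triangle_left ⟨n⟩

theorem up_cup_cap (n : ℕ) : up (cup n) ≫ cap (n + 1) = 𝟙 (KC.mk (n + 1)) :=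
  adj.triangle_right ⟨n⟩

theorem cup_up_cap_assoc (f : Arr (n + 1) k) : cup (n + 1) ≫ up (cap n) ≫ f = f := by
  rw [← Category.assoc, cup_up_cap, Category.id_comp]

theorem up_cup_cap_assoc (f : Arr (n + 1) k) : up (cup n) ≫ cap (n + 1) ≫ f = f := by
  rw [← Category.assoc, up_cup_cap, Category.id_comp]

theorem up_circ (n : ℕ) : up (circ n) = circ (n + 1) := adj.circle ⟨n⟩

/-- Naturality of γ and φ slides `f`, doubled by the functor, through the circle; so circles are
central. -/
theorem circ_comp (f : Arr m n) : circ m ≫ f = f ≫ circ n := by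
  rw [circ, circ, Category.assoc, ← up_up_cap, cup_up_up_assoc]

theorem diap_top (n : ℕ) : diap (n + 2) n = cap n ≫ cup n := by
  rw [diap, if_pos rfl]

theorem diap_up {i : ℕ} (h : i + 1 < n) : diap (n + 1) i = up (diap n i) := by
  obtain ⟨n, rfl⟩ : ∃ k, n = k + 1 := ⟨n - 1, by omega⟩
  rw [diap, if_neg (by omega)]

theorem diap_up_up {i : ℕ} (h : i + 1 < n) : diap (n + 2) i = up (up (diap n i)) := by
  rw [diap_up (by omega), diap_up h]

theorem diap_diap (i : ℕ) (h : i + 1 < n) : diap n i ≫ diap n i = circ n ≫ diap n i := by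
  induction n with
  | zero => omega
  | succ n ih =>
    by_cases hi : i + 1 < n
    · rw [diap_up hi, ← up_comp, ih hi, up_comp, up_circ]
    · obtain ⟨n, rfl⟩ : ∃ k, n = k + 1 := ⟨n - 1, by omega⟩
      obtain rfl : i = n := by omega
      rw [diap_top, ← Category.assoc, circ_comp]
      simp only [Category.assoc]
      rw [← circ_comp (cup i), circ, Category.assoc]

theorem diap_comm {i j : ℕ} (hij : i + 2 ≤ j) (hj : j + 1 < n) :
    diap n i ≫ diap n j = diap n j ≫ diap n i := by
  induction n with
  | zero => omega
  | succ n ih =>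
    by_cases h : j + 1 < n
    · rw [diap_up h, diap_up (by omega), ← up_comp, ih h, up_comp]
    · obtain ⟨n, rfl⟩ : ∃ k, n = k + 1 := ⟨n - 1, by omega⟩
      obtain rfl : j = n := by omega
      rw [diap_top, diap_up_up (by omega), up_up_cap_assoc, Category.assoc, cup_up_up]

/-- Removing outer strands leaves the two topmost diapsides, where the relations are the two
triangle identities. -/
theorem diap_zigzag {i : ℕ} (h : i + 2 < n) :
    diap n i ≫ diap n (i + 1) ≫ diap n i = diap n i ∧
    diap n (i + 1) ≫ diap n i ≫ diap n (i + 1) = diap n (i + 1) := by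
  induction n with
  | zero => omega
  | succ n ih =>
    by_cases hi : i + 2 < n
    · rw [diap_up (by omega), diap_up (by omega), ← up_comp, ← up_comp, ← up_comp, ← up_comp]
      exact ⟨congrArg up (ih hi).1, congrArg up (ih hi).2⟩
    · obtain ⟨n, rfl⟩ : ∃ k, n = k + 2 := ⟨n - 2, by omega⟩
      obtain rfl : i = n := by omega
      rw [diap_up (by omega), diap_top, diap_top, up_comp]
      constructor
      · simp only [Category.assoc]
        rw [up_cup_cap_assoc, cup_up_cap_assoc]
      · simp only [Category.assoc]
        rw [cup_up_cap_assoc, up_cup_cap_assoc]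

/-- Composites of diapsides and circles. -/
inductive IsWord : Arr n n → Prop
  | id : IsWord (𝟙 _)
  | circ (f : Arr n n) : IsWord f → IsWord (f ≫ circ n)
  | diap (f : Arr n n) (i : ℕ) : i + 1 < n → IsWord f → IsWord (f ≫ diap n i)

theorem IsWord.comp {f g : Arr n n} (hf : IsWord f) (hg : IsWord g) : IsWord (f ≫ g) := by
  induction hg with
  | id => rwa [Category.comp_id]
  | circ g _ ih => rw [← Category.assoc]; exact ih.circ
  | diap g i hi _ ih => rw [← Category.assoc]; exact ih.diap _ _ hi

theorem IsWord.up {f : Arr n n} (hf : IsWord f) : IsWord (up f) := by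
  induction hf with
  | id => rw [up_id]; exact .id
  | circ g _ ih => rw [up_comp, up_circ]; exact ih.circ
  | diap g i hi _ ih => rw [up_comp, ← diap_up hi]; exact ih.diap _ _ (by omega)

theorem isWord_circ : IsWord (KC.circ n) := by
  simpa using IsWord.id.circ

theorem isWord_cap_cup : IsWord (cap n ≫ cup n) := by
  have h := (IsWord.id (n := n + 2)).diap _ n (by omega)
  rwa [diap_top, Category.id_comp] at h

/-! ### Reducing words to one occurrence of the topmost diapsis -/

/-- Words in which the topmost diapsis occurs at most once. -/
inductive IsSplit : {n : ℕ} → Arr n n → Prop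
  | low {n : ℕ} (u : Arr n n) : IsWord u → IsSplit (KC.up u)
  | mid {n : ℕ} (u v : Arr (n + 1) (n + 1)) : IsWord u → IsWord v →
      IsSplit (KC.up u ≫ cap n ≫ cup n ≫ KC.up v)

theorem IsSplit.comp_up {f : Arr (n + 1) (n + 1)} (hf : IsSplit f) {w : Arr n n} (hw : IsWord w) :
    IsSplit (f ≫ KC.up w) := by
  cases hf with
  | low u hu => rw [← up_comp]; exact .low _ (hu.comp hw)
  | mid u v hu hv => simp only [Category.assoc, ← up_comp]; exact .mid _ _ hu (hv.comp hw)

/-- Two topmost diapsides separated by a word `v` on one strand fewer merge into one. Split `v` in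
turn: if it avoids its own topmost diapsis, it slides out and a circle is left; otherwise its single
diapsis is swallowed by the triangle identities. -/
theorem IsSplit.comp_cap_cup (IH : ∀ u : Arr (n + 1) (n + 1), IsWord u → IsSplit u)
    {f : Arr (n + 2) (n + 2)} (hf : IsSplit f) : IsSplit (f ≫ cap n ≫ cup n) := by
  cases hf with
  | low u hu =>
    have h := IsSplit.mid u (𝟙 _) hu .id
    rwa [up_id, Category.comp_id] at h
  | mid u v hu hv =>
    cases IH v hv with
    | low a ha =>
      have h := IsSplit.mid u (KC.up (a ≫ circ n)) hu (ha.comp isWord_circ).up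
      convert h using 1
      simp only [Category.assoc, cup_up_up, circ]
    | mid a b ha hb =>
      have h := IsSplit.mid (u ≫ KC.up a) (KC.up b) (hu.comp ha.up) hb.up
      convert h using 1
      simp only [Category.assoc, up_comp, up_up_cap_assoc, cup_up_cap_assoc, up_cup_cap_assoc,
        cup_up_up_assoc, cup_up_up]

theorem IsWord.isSplit {f : Arr (n + 1) (n + 1)} (hf : IsWord f) : IsSplit f := by
  induction n with
  | zero =>
    induction hf with
    | id => rw [← up_id]; exact .low _ .id
    | circ g _ ih => rw [← up_circ]; exact ih.comp_up isWord_circ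
    | diap g i hi _ ih => omega
  | succ n IH =>
    induction hf with
    | id => rw [← up_id]; exact .low _ .id
    | circ g _ ih => rw [← up_circ]; exact ih.comp_up isWord_circ
    | diap g i hi _ ih =>
      by_cases h : i + 1 < n + 1
      · rw [diap_up h]
        have h' := IsWord.id.diap _ i h
        rw [Category.id_comp] at h'
        exact ih.comp_up h'
      · obtain rfl : i = n := by omega
        rw [diap_top]
        exact ih.comp_cap_cup (fun u hu => IH hu)

/-- Closing a strand of a word gives a word: the split form of `u` yields either a circle or a
zigzag that straightens. -/
theorem IsWord.cup_up_cap {u : Arr (n + 1) (n + 1)} (hu : IsWord u) :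
    IsWord (cup n ≫ KC.up u ≫ cap n) := by
  cases hu.isSplit with
  | low a ha =>
    rw [up_up_cap, ← Category.assoc]
    exact isWord_circ.comp ha
  | mid a b ha hb =>
    simp only [up_comp, Category.assoc, up_up_cap, cup_up_up_assoc, cup_up_cap_assoc,
      up_cup_cap_assoc]
    exact ha.comp hb

theorem IsWord.cup_cap {w : Arr (n + 2) (n + 2)} (hw : IsWord w) :
    IsWord (cup n ≫ w ≫ cap n) := by
  cases hw.isSplit with
  | low u hu => exact hu.cup_up_cap
  | mid a b ha hb =>
    have h := ha.cup_up_cap.comp hb.cup_up_cap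
    simpa only [Category.assoc] using h

/-! ### Factoring arbitrary arrows through words with only cups or only caps -/

/-- Arrows obtained from words by adding cups on top. -/
inductive IsUp : {m n : ℕ} → Arr m n → Prop
  | base {n : ℕ} (w : Arr n n) : IsWord w → IsUp w
  | step {m n : ℕ} (f : Arr m n) (w : Arr (n + 2) (n + 2)) : IsUp f → IsWord w →
      IsUp (f ≫ cup n ≫ w)

/-- Arrows obtained from words by adding caps at the bottom. -/
inductive IsDown : {m n : ℕ} → Arr m n → Prop
  | base {n : ℕ} (w : Arr n n) : IsWord w → IsDown w
  | step {m n : ℕ} (f : Arr m n) (w : Arr (m + 2) (m + 2)) : IsDown f → IsWord w →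
      IsDown (w ≫ cap m ≫ f)

/-- A lifted cup is an unlifted cup followed by a word, so paths need no lifted cups or caps as
generators. -/
theorem up_cup (n : ℕ) : up (cup n) = cup (n + 1) ≫ up (cap n ≫ cup n) := by
  rw [up_comp, cup_up_cap_assoc]

theorem up_cap (n : ℕ) : up (cap n) = up (cap n ≫ cup n) ≫ cap (n + 1) := by
  rw [up_comp, Category.assoc, up_cup_cap, Category.comp_id]

theorem IsUp.comp_word {f : Arr m n} (hf : IsUp f) {w : Arr n n} (hw : IsWord w) :
    IsUp (f ≫ w) := by
  cases hf with
  | base v hv => exact .base _ (hv.comp hw)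
  | step f v hf hv => simp only [Category.assoc]; exact .step _ _ hf (hv.comp hw)

theorem IsDown.comp_word {f : Arr m n} (hf : IsDown f) {w : Arr n n} (hw : IsWord w) :
    IsDown (f ≫ w) := by
  induction hf with
  | base v hv => exact .base _ (hv.comp hw)
  | step f v hf hv ih => simp only [Category.assoc]; exact .step _ _ (ih hw) hv

theorem IsDown.word_comp {f : Arr m n} (hf : IsDown f) {w : Arr m m} (hw : IsWord w) :
    IsDown (w ≫ f) := by
  cases hf with
  | base v hv => exact .base _ (hw.comp hv)
  | step f v hf hv => rw [← Category.assoc]; exact .step _ _ hf (hw.comp hv)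

theorem IsDown.up {f : Arr m n} (hf : IsDown f) : IsDown (KC.up f) := by
  induction hf with
  | base v hv => exact .base _ hv.up
  | step f v hf hv ih =>
    rw [up_comp, up_comp, up_cap, Category.assoc, ← Category.assoc]
    exact .step _ _ ih (hv.up.comp isWord_cap_cup.up)

theorem IsDown.comp_cap {f : Arr m (n + 2)} (hf : IsDown f) : IsDown (f ≫ cap n) := by
  -- The target `n + 2` is freed to a variable `k`, with a transport, so that induction on `IsDown`
  -- applies.
  suffices key : ∀ {m k : ℕ} {f : Arr m k}, IsDown f → ∀ (n : ℕ) (h : k = n + 2),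
      IsDown (f ≫ eqToHom (congrArg KC.mk h) ≫ cap n) by
    simpa using key hf n rfl
  intro m k f hf n h
  induction hf with
  | base w hw =>
    subst h
    have h := IsDown.step (𝟙 _) w (.base _ .id) hw
    simpa using h
  | step f w hf hw ih =>
    simp only [Category.assoc]
    exact .step _ _ (ih h) hw

/-- Arrows that are obtained from words by adding cups only or caps only. -/
def IsUpDown (f : Arr m n) : Prop := IsUp f ∨ IsDown f

theorem IsUpDown.comp_word {f : Arr m n} (hf : IsUpDown f) {w : Arr n n} (hw : IsWord w) :
    IsUpDown (f ≫ w) :=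
  hf.imp (·.comp_word hw) (·.comp_word hw)

theorem IsUpDown.comp_cup {f : Arr m n} (hf : IsUpDown f) : IsUpDown (f ≫ cup n) := by
  have key {m n : ℕ} {f : Arr m n} (hf : IsUp f) : IsUpDown (f ≫ cup n) := by
    have h := IsUp.step f (𝟙 _) hf .id
    rw [Category.comp_id] at h
    exact .inl h
  rcases hf with hf | hf
  · exact key hf
  · cases hf with
    | base w hw => exact key (.base _ hw)
    | step f w hf hw =>
      -- Naturality moves the new cup back past `f` to meet the cap; together they form a diapsis,
      -- absorbed by the word.
      rw [Category.assoc, Category.assoc, ← cup_up_up]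
      refine .inr ?_
      have h := hf.up.up.word_comp (hw.comp isWord_cap_cup)
      simpa only [Category.assoc] using h

theorem IsUpDown.comp_cap {f : Arr m (n + 2)} (hf : IsUpDown f) : IsUpDown (f ≫ cap n) := by
  rcases hf with hf | hf
  · cases hf with
    | base w hw => exact .inr (IsDown.base _ hw).comp_cap
    | step f w hf hw =>
      simp only [Category.assoc]
      exact .inl (hf.comp_word hw.cup_cap)
  · exact .inr hf.comp_cap

/-- Composites of words, cups and caps. -/
inductive IsPath : {m n : ℕ} → Arr m n → Prop
  | id (n : ℕ) : IsPath (𝟙 (KC.mk n))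
  | word {m n : ℕ} (f : Arr m n) (w : Arr n n) : IsPath f → IsWord w → IsPath (f ≫ w)
  | cup {m n : ℕ} (f : Arr m n) : IsPath f → IsPath (f ≫ KC.cup n)
  | cap {m n : ℕ} (f : Arr m (n + 2)) : IsPath f → IsPath (f ≫ KC.cap n)

theorem IsPath.comp {f : Arr k m} {g : Arr m n} (hf : IsPath f) (hg : IsPath g) :
    IsPath (f ≫ g) := by
  induction hg with
  | id => rwa [Category.comp_id]
  | word g w _ hw ih => rw [← Category.assoc]; exact .word _ _ ih hw
  | cup g _ ih => rw [← Category.assoc]; exact .cup _ ih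
  | cap g _ ih => rw [← Category.assoc]; exact .cap _ ih

theorem IsPath.up {f : Arr m n} (hf : IsPath f) : IsPath (KC.up f) := by
  induction hf with
  | id => rw [up_id]; exact .id _
  | word g w _ hw ih => rw [up_comp]; exact .word _ _ ih hw.up
  | cup g _ ih =>
    rw [up_comp, up_cup, ← Category.assoc]
    exact .word _ _ (.cup _ ih) isWord_cap_cup.up
  | cap g _ ih =>
    rw [up_comp, up_cap, ← Category.assoc]
    exact .cap _ (.word _ _ ih isWord_cap_cup.up)

theorem isPath (f : Arr m n) : IsPath f := by
  obtain ⟨f, rfl⟩ : ∃ t : ArrowTerm m n, arrow t = f := Quotient.exists_rep f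
  induction f with
  | one n => exact .id n
  | phi n =>
    have h := IsPath.cap _ (.id (n + 2))
    rw [Category.id_comp] at h
    exact h
  | gam n =>
    have h := IsPath.cup _ (.id n)
    rw [Category.id_comp] at h
    exact h
  | F f ih => exact ih.up
  | comp g f ihg ihf => exact ihf.comp ihg

theorem IsPath.isUpDown {f : Arr m n} (hf : IsPath f) : IsUpDown f := by
  induction hf with
  | id => exact .inl (.base _ .id)
  | word f w _ hw ih => exact ih.comp_word hw
  | cup f _ ih => exact ih.comp_cup
  | cap f _ ih => exact ih.comp_cap

/-- Each added cup raises the target by two, so equal source and target leave only the base case.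
`HEq` is needed because this equality is between varying indices. -/
theorem IsUp.le_and {f : Arr m n} (hf : IsUp f) :
    m ≤ n ∧ (m = n → ∃ w : Arr n n, IsWord w ∧ HEq f w) := by
  induction hf with
  | base w hw => exact ⟨le_rfl, fun _ => ⟨w, hw, HEq.rfl⟩⟩
  | step f w hf hw ih => exact ⟨by omega, fun h => by omega⟩

theorem IsDown.le_and {f : Arr m n} (hf : IsDown f) :
    n ≤ m ∧ (m = n → ∃ w : Arr n n, IsWord w ∧ HEq f w) := by
  induction hf with
  | base w hw => exact ⟨le_rfl, fun _ => ⟨w, hw, HEq.rfl⟩⟩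
  | step f w hf hw ih => exact ⟨by omega, fun h => by omega⟩

/-- Every endomorphism in `K_c` is a composite of diapsides and circles. -/
theorem isWord (f : Arr n n) : IsWord f := by
  obtain ⟨w, hw, h⟩ := (isPath f).isUpDown.elim (fun h => h.le_and.2 rfl) (fun h => h.le_and.2 rfl)
  rwa [eq_of_heq h]

end KC

end SelfAdjoint

/-! ### Jones normal form -/

namespace SelfAdjoint

/-- The defining equations of `K_n` for the elements `h 0, …, h (N - 1)` and `c` of a monoid. -/
structure IsTemperleyLieb {M : Type*} [Monoid M] (N : ℕ) (h : ℕ → M) (c : M) : Prop where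
  comm : ∀ i j, i + 2 ≤ j → j < N → h i * h j = h j * h i
  zigzag : ∀ i, i + 1 < N → h i * h (i + 1) * h i = h i
  zigzag' : ∀ i, i + 1 < N → h (i + 1) * h i * h (i + 1) = h (i + 1)
  circ : ∀ i, i < N → h i * c = c * h i
  sq : ∀ i, i < N → h i * h i = c * h i

section Words

variable {M : Type*} [Monoid M]

/-- The product `h a * h (a + 1) * ⋯ * h b`. -/
def run (h : ℕ → M) (a b : ℕ) : M := ((List.range' a (b + 1 - a)).map h).prod

/-- The product of a list of runs. -/
def runs (h : ℕ → M) (L : List (ℕ × ℕ)) : M := (L.map fun x => run h x.1 x.2).prod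

/-- Lists of runs with strictly decreasing last letters, all below `N`. -/
def Descending : ℕ → List (ℕ × ℕ) → Prop
  | _, [] => True
  | N, x :: L => x.1 ≤ x.2 ∧ x.2 < N ∧ Descending x.2 L

/-- Lists of runs in Jones normal form: the first letters, below `A`, and the last letters, below
`N`, are strictly decreasing. -/
def IsJones : ℕ → ℕ → List (ℕ × ℕ) → Prop
  | _, _, [] => True
  | A, N, x :: L => x.1 ≤ x.2 ∧ x.1 < A ∧ x.2 < N ∧ IsJones x.1 x.2 L

/-- The number of letters in a list of runs. -/
def runsLength (L : List (ℕ × ℕ)) : ℕ := (L.map fun x => x.2 + 1 - x.1).sum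

variable {h : ℕ → M} {c : M} {N a b : ℕ} {L : List (ℕ × ℕ)}

theorem run_of_lt (hab : b < a) : run h a b = 1 := by
  simp [run, Nat.sub_eq_zero_of_le hab]

theorem run_cons (hab : a ≤ b) : run h a b = h a * run h (a + 1) b := by
  have : b + 1 - a = (b + 1 - (a + 1)) + 1 := by omega
  simp [run, this, List.range'_succ]

theorem run_self (a : ℕ) : run h a a = h a := by
  rw [run_cons le_rfl, run_of_lt (by omega), mul_one]

theorem run_append {m : ℕ} (hm : m ≤ b) (ha : a ≤ m + 1) :
    run h a b = run h a m * run h (m + 1) b := by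
  obtain ⟨d, hd⟩ : ∃ d, d = m + 1 - a := ⟨_, rfl⟩
  induction d generalizing a with
  | zero =>
    obtain rfl : a = m + 1 := by omega
    rw [run_of_lt (b := m) (by omega), one_mul]
  | succ d ih =>
    rw [run_cons (by omega), run_cons (b := m) (by omega), ih (by omega) (by omega), mul_assoc]

theorem commute_run {x : M} (hx : ∀ j, a ≤ j → j ≤ b → Commute x (h j)) :
    Commute x (run h a b) := by
  refine Commute.list_prod_right _ _ fun y hy => ?_
  obtain ⟨j, hj, rfl⟩ := List.mem_map.1 hy
  rw [List.mem_range'_1] at hj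
  exact hx j hj.1 (by omega)

@[simp] theorem runs_nil : runs h [] = 1 := rfl

@[simp] theorem runs_cons (x : ℕ × ℕ) : runs h (x :: L) = run h x.1 x.2 * runs h L := by
  simp [runs]

namespace IsTemperleyLieb

variable {T : ℕ}

theorem commute (hT : IsTemperleyLieb T h c) {i j : ℕ} (hij : i + 2 ≤ j) (hj : j < T) :
    Commute (h i) (h j) := hT.comm i j hij hj

theorem commute_circ_run (hT : IsTemperleyLieb T h c) (hb : b < T) : Commute c (run h a b) :=
  commute_run fun j _ hj => (hT.circ j (by omega)).symm

theorem commute_run_run (hT : IsTemperleyLieb T h c) {a' b' : ℕ} (hb : b + 2 ≤ a') (hb' : b' < T) :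
    Commute (run h a b) (run h a' b') :=
  commute_run fun j hj hj' => (commute_run fun i _ _ => (hT.commute (by omega) (by omega)).symm).symm

theorem run_mul_mul (hT : IsTemperleyLieb T h c) (hab : a ≤ b) (hb : b + 1 < T) :
    run h a b * h (b + 1) * h b = run h a b := by
  obtain ⟨d, hd⟩ : ∃ d, d = b - a := ⟨_, rfl⟩
  induction d generalizing a with
  | zero =>
    obtain rfl : a = b := by omega
    rw [run_self, hT.zigzag _ hb]
  | succ d ih =>
    have := ih (a := a + 1) (by omega) (by omega)
    rw [run_cons hab, mul_assoc, mul_assoc, ← mul_assoc (run h _ _), this]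

/-- Two runs whose first letters fail to decrease are rewritten with the first letters in order. The
word loses two letters, which makes normalisation terminate. -/
theorem run_mul_run (hT : IsTemperleyLieb T h c) {a' b' : ℕ} (h1 : a ≤ a') (h2 : a' ≤ b')
    (h3 : b' < b) (hb : b < T) :
    run h a b * run h a' b' = run h (a' + 2) b * run h a b' := by
  have hc : Commute (run h (a' + 2) b) (h a') :=
    (commute_run fun j _ _ => hT.commute (by omega) (by omega)).symm
  have hc' : Commute (run h a a') (run h (a' + 2) b) := hT.commute_run_run le_rfl hb
  calc run h a b * run h a' b'
      = run h a a' * h (a' + 1) * (run h (a' + 2) b * h a') * run h (a' + 1) b' := by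
        rw [run_append (m := a') (by omega) (by omega), run_cons (a := a' + 1) (by omega),
          run_cons (a := a') h2]
        simp only [mul_assoc]
    _ = (run h a a' * h (a' + 1) * h a') * run h (a' + 2) b * run h (a' + 1) b' := by
        rw [hc.eq]; simp only [mul_assoc]
    _ = run h (a' + 2) b * run h a b' := by
        rw [hT.run_mul_mul h1 (by omega), hc'.eq, mul_assoc,
          ← run_append (m := a') (by omega) (by omega)]

theorem mul_run_far (hT : IsTemperleyLieb T h c) {m : ℕ} (h1 : a ≤ m) (h2 : m + 2 ≤ b)
    (hb : b < T) : h (m + 2) * run h a b = run h (m + 2) b * run h a m := by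
  have hc : Commute (h (m + 2)) (run h a m) :=
    commute_run fun j _ _ => (hT.commute (by omega) (by omega)).symm
  have hc' : Commute (run h a m) (run h (m + 2) b) := hT.commute_run_run le_rfl hb
  calc h (m + 2) * run h a b
      = (h (m + 2) * run h a m) * h (m + 1) * h (m + 2) * run h (m + 3) b := by
        rw [run_append (m := m) (by omega) (by omega), run_cons (a := m + 1) (by omega),
          run_cons (a := m + 2) (by omega)]
        simp only [mul_assoc]
    _ = run h a m * (h (m + 2) * h (m + 1) * h (m + 2)) * run h (m + 3) b := by
        rw [hc.eq]; simp only [mul_assoc]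
    _ = run h (m + 2) b * run h a m := by
        rw [hT.zigzag' _ (by omega), mul_assoc, ← run_cons h2, hc'.eq]

theorem circ_pow_run (hT : IsTemperleyLieb T h c) (hb : b < T) (k : ℕ) (x : M) :
    run h a b * (c ^ k * x) = c ^ k * (run h a b * x) := by
  rw [← mul_assoc, ← mul_assoc, ((hT.commute_circ_run hb).pow_left k).eq]

/-- Compare the letter `i` with the leading run a, …, b. It starts a new run (i > b), gives a circle
(i = a), prolongs the run (i + 1 = a), is absorbed with h_a (i = a + 1), or passes to the tail (i +
1 < a). For a + 2 ≤ i ≤ b, `mul_run_far` replaces the leading run by i, …, b and sends the run a, …,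
i - 2 to the tail. -/
theorem exists_descending_mul (hT : IsTemperleyLieb T h c) (N : ℕ) (hN : N ≤ T) :
    ∀ (L : List (ℕ × ℕ)) (i : ℕ), Descending N L → i < N →
      ∃ k L', Descending N L' ∧ h i * runs h L = c ^ k * runs h L' := by
  induction N using Nat.strong_induction_on with
  | _ N IH =>
    -- The last case multiplies the tail by a whole run, done here letter by letter under the
    -- smaller bound `b`.
    have IH' : ∀ b < N, ∀ d i j L, Descending b L → j < b → d = j + 1 - i →
        ∃ k L', Descending b L' ∧ run h i j * runs h L = c ^ k * runs h L' := by
      intro b hb d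
      induction d with
      | zero =>
        intro i j L hL hj hd
        exact ⟨0, L, hL, by rw [run_of_lt (by omega), pow_zero]⟩
      | succ d ih =>
        intro i j L hL hj hd
        obtain ⟨k, L', hL', e⟩ := ih (i + 1) j L hL hj (by omega)
        obtain ⟨k', L'', hL'', e'⟩ := IH b hb (by omega) L' i hL' (by omega)
        refine ⟨k + k', L'', hL'', ?_⟩
        have := hT.circ_pow_run (a := i) (b := i) (by omega) k (runs h L')
        rw [run_self] at this
        rw [run_cons (by omega), mul_assoc, e, this, e', pow_add, mul_assoc]
    rintro (_ | ⟨⟨a, b⟩, L⟩) i hL hi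
    · exact ⟨0, [(i, i)], ⟨le_rfl, hi, trivial⟩, by simp [run_self]⟩
    obtain ⟨hab, hbN, hL⟩ := hL
    simp only at hab hbN hL
    rw [runs_cons]
    simp only
    by_cases h1 : b < i
    · exact ⟨0, (i, i) :: (a, b) :: L, ⟨le_rfl, hi, hab, h1, hL⟩, by simp [run_self]⟩
    by_cases h2 : i = a
    · subst h2
      refine ⟨1, (i, b) :: L, ⟨hab, hbN, hL⟩, ?_⟩
      rw [runs_cons, run_cons hab, ← mul_assoc, ← mul_assoc, hT.sq i (by omega), pow_one]
      simp only [mul_assoc]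
    by_cases h3 : i + 1 = a
    · subst h3
      refine ⟨0, (i, b) :: L, ⟨by omega, hbN, hL⟩, ?_⟩
      rw [runs_cons, run_cons (a := i) (by omega), pow_zero, one_mul, mul_assoc]
    by_cases h4 : i = a + 1
    · subst h4
      refine ⟨0, (a + 1, b) :: L, ⟨by omega, hbN, hL⟩, ?_⟩
      rw [runs_cons, run_cons hab, run_cons (a := a + 1) (by omega), pow_zero, one_mul]
      simp only [← mul_assoc]
      rw [hT.zigzag' a (by omega)]
    by_cases h5 : i < a
    · obtain ⟨k, L', hL', e⟩ := IH b hbN (by omega) L i hL (by omega)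
      have hc : Commute (h i) (run h a b) :=
        commute_run fun j _ _ => hT.commute (by omega) (by omega)
      refine ⟨k, (a, b) :: L', ⟨hab, hbN, hL'⟩, ?_⟩
      rw [← mul_assoc, hc.eq, mul_assoc, e, runs_cons, hT.circ_pow_run (by omega)]
    · obtain ⟨m, rfl⟩ : ∃ m, i = m + 2 := ⟨i - 2, by omega⟩
      obtain ⟨k, L', hL', e⟩ := IH' b hbN _ a m L hL (by omega) rfl
      refine ⟨k, (m + 2, b) :: L', ⟨by omega, hbN, hL'⟩, ?_⟩
      rw [← mul_assoc, hT.mul_run_far (by omega) (by omega) (by omega), mul_assoc, e, runs_cons,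
        hT.circ_pow_run (by omega)]

/-- Normalise the tail; if its first run starts at or after `a`, `run_mul_run` shortens the word and
the process restarts. -/
theorem exists_jones_of_descending (hT : IsTemperleyLieb T h c) (l : ℕ) :
    ∀ N L, N ≤ T → Descending N L → runsLength L ≤ l →
      ∃ L', IsJones N N L' ∧ runsLength L' ≤ runsLength L ∧ runs h L = runs h L' := by
  induction l using Nat.strong_induction_on with
  | _ l IH =>
    rintro N (_ | ⟨⟨a, b⟩, L⟩) hN hL hl
    · exact ⟨[], trivial, le_rfl, rfl⟩
    obtain ⟨hab, hbN, hL⟩ := hL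
    simp only at hab hbN hL
    have hlen : ∀ a b L, runsLength ((a, b) :: L) = b + 1 - a + runsLength L := by
      intro a b L; simp [runsLength]
    rw [hlen] at hl
    obtain ⟨L', hJ, hl', e⟩ := IH (runsLength L) (by omega) b L (by omega) hL le_rfl
    rcases L' with _ | ⟨⟨a', b'⟩, R⟩
    · refine ⟨[(a, b)], ⟨hab, by simp only; omega, hbN, trivial⟩, ?_, ?_⟩
      · simp [runsLength]
      · simp [e]
    obtain ⟨h1, h2, h3, h4⟩ := hJ
    simp only at h1 h2 h3 h4
    by_cases haa : a' < a
    · refine ⟨(a, b) :: (a', b') :: R, ⟨hab, by simp only; omega, hbN, h1, haa, h3, h4⟩, ?_, ?_⟩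
      · rw [hlen a b, hlen a b]; omega
      · rw [runs_cons, e, ← runs_cons]
    have hD : ∀ {A N R}, IsJones A N R → Descending N R := by
      intro A N R hR
      induction R generalizing A N with
      | nil => trivial
      | cons x R ih => exact ⟨hR.1, hR.2.2.1, ih hR.2.2.2⟩
    rw [hlen] at hl'
    have e1 : runs h ((a, b) :: L) = run h (a' + 2) b * runs h ((a, b') :: R) := by
      rw [runs_cons, e, runs_cons, runs_cons, ← mul_assoc,
        hT.run_mul_run (by omega) h1 h3 (by omega), mul_assoc]
    by_cases hb : a' + 2 ≤ b
    · obtain ⟨L'', hJ', hl'', e'⟩ := IH (runsLength ((a' + 2, b) :: (a, b') :: R))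
        (by rw [hlen, hlen]; omega) N ((a' + 2, b) :: (a, b') :: R) hN
        ⟨hb, hbN, by simp only; omega, h3, hD h4⟩ le_rfl
      rw [hlen, hlen] at hl''
      exact ⟨L'', hJ', by rw [hlen]; omega, by rw [e1, ← e', runs_cons (x := (a' + 2, b))]⟩
    -- Here b = a' + 1: the run from `a' + 2` to `b` is empty and must be dropped.
    · obtain ⟨L'', hJ', hl'', e'⟩ := IH (runsLength ((a, b') :: R))
        (by rw [hlen]; omega) N ((a, b') :: R) hN
        ⟨by simp only; omega, by simp only; omega, hD h4⟩ le_rfl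
      rw [hlen] at hl''
      exact ⟨L'', hJ', by rw [hlen]; omega, by rw [e1, ← e', run_of_lt (by omega), one_mul]⟩

end IsTemperleyLieb

end Words

/-- The diapsides of `K_n`, with value `1` outside the range of indices. -/
def kmonH (n i : ℕ) : KMon n :=
  if hi : i < n - 1 then PresentedMonoid.of (KRel n) (.h ⟨i, hi⟩) else 1

/-- The circle of `K_n`. -/
def kmonC (n : ℕ) : KMon n := PresentedMonoid.of (KRel n) .c

theorem isTemperleyLieb_kmon (n : ℕ) : IsTemperleyLieb (n - 1) (kmonH n) (kmonC n) where
  comm i j hij hj := by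
    rw [kmonH, kmonH, dif_pos (by omega), dif_pos hj]
    exact PresentedMonoid.mk_eq_mk_of_rel (.h_comm _ _ hij)
  zigzag i hi := by
    rw [kmonH, kmonH, dif_pos (show i < n - 1 by omega), dif_pos hi]
    exact PresentedMonoid.mk_eq_mk_of_rel (.h_succ _ _ rfl)
  zigzag' i hi := by
    rw [kmonH, kmonH, dif_pos (show i < n - 1 by omega), dif_pos hi]
    exact PresentedMonoid.mk_eq_mk_of_rel (.h_pred _ _ rfl)
  circ i hi := by
    rw [kmonH, dif_pos hi]
    exact PresentedMonoid.mk_eq_mk_of_rel (.h_circle _)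
  sq i hi := by
    rw [kmonH, dif_pos hi]
    exact PresentedMonoid.mk_eq_mk_of_rel (.h_sq _)

/-- Every element of `K_n` has a Jones normal form. -/
theorem exists_jones (n : ℕ) (x : KMon n) :
    ∃ k L, IsJones (n - 1) (n - 1) L ∧ x = kmonC n ^ k * runs (kmonH n) L := by
  have hT := isTemperleyLieb_kmon n
  suffices h : ∃ k L, Descending (n - 1) L ∧ x = kmonC n ^ k * runs (kmonH n) L by
    obtain ⟨k, L, hL, rfl⟩ := h
    obtain ⟨L', hJ, -, e⟩ := hT.exists_jones_of_descending _ _ L le_rfl hL le_rfl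
    exact ⟨k, L', hJ, by rw [e]⟩
  obtain ⟨w, rfl⟩ := PresentedMonoid.surjective_mk x
  induction w using FreeMonoid.inductionOn' with
  | one => exact ⟨0, [], trivial, by simp⟩
  | of_mul g w ih =>
    obtain ⟨k, L, hL, e⟩ := ih
    rw [map_mul, e]
    cases g with
    | h i =>
      obtain ⟨k', L', hL', e'⟩ := hT.exists_descending_mul _ le_rfl L i hL i.2
      have hi : PresentedMonoid.mk (KRel n) (FreeMonoid.of (.h i)) = kmonH n i := by
        rw [kmonH, dif_pos i.2]; rfl
      refine ⟨k + k', L', hL', ?_⟩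
      have := hT.circ_pow_run (a := i) (b := i) i.2 k (runs (kmonH n) L)
      rw [run_self] at this
      rw [hi, this, e', pow_add, mul_assoc]
    | c => exact ⟨k + 1, L, hL, by rw [pow_succ', mul_assoc]; rfl⟩

end SelfAdjoint

/-! ### Normal forms as operators on functions of sequences -/

namespace SelfAdjoint

section Operators

variable {p : ℕ}

/-- Replace the entries `k` and `k + 1` of a sequence by `t`. -/
def setTwo (x : ℕ → Fin p) (k : ℕ) (t : Fin p) : ℕ → Fin p :=
  fun j => if j = k ∨ j = k + 1 then t else x j

/-- The operator by which the diapsis on the strands `k` and `k + 1` acts on functions of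
sequences. -/
def diapOp (S : Type*) [AddCommMonoid S] (p k : ℕ) : Function.End ((ℕ → Fin p) → S) :=
  fun f x => if x k = x (k + 1) then ∑ t, f (setTwo x k t) else 0

/-- Delete the entries `a` and `a + 1` of a sequence and insert two entries `t` at the places
`b` and `b + 1`. -/
def shift (a b : ℕ) (t : Fin p) (x : ℕ → Fin p) : ℕ → Fin p :=
  fun j => if j < a then x j else if j < b then x (j + 2) else if j ≤ b + 1 then t else x j

/-- After the first letter has inserted a pair `t`, the next one demands t = x_{a+2}; one summand
survives, and the inserted pair moves one place on. -/
theorem run_diapOp {a b : ℕ} (hab : a ≤ b) (f : (ℕ → Fin p) → ℕ) (x : ℕ → Fin p) :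
    run (diapOp ℕ p) a b f x = if x a = x (a + 1) then ∑ t, f (shift a b t x) else 0 := by
  obtain ⟨d, hd⟩ : ∃ d, d = b - a := ⟨_, rfl⟩
  induction d generalizing a x with
  | zero =>
    obtain rfl : a = b := by omega
    rw [run_self, diapOp]
    have : ∀ t, setTwo x a t = shift a a t x := by
      intro t; funext j
      simp only [setTwo, shift]
      split_ifs <;> first | rfl | omega
    simp only [this]
  | succ d ih =>
    rw [run_cons hab]
    change diapOp ℕ p a (run (diapOp ℕ p) (a + 1) b f) x = _
    rw [diapOp]
    split_ifs with hx
    · have h1 : ∀ t, run (diapOp ℕ p) (a + 1) b f (setTwo x a t) =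
          if t = x (a + 2) then ∑ s, f (shift a b s x) else 0 := by
        intro t
        rw [ih (by omega) _ (by omega)]
        have e1 : setTwo x a t (a + 1) = t := by simp [setTwo]
        have e2 : setTwo x a t (a + 1 + 1) = x (a + 2) := by simp [setTwo]; omega
        rw [e1, e2]
        split_ifs with ht
        · refine Finset.sum_congr rfl fun s _ => congrArg f (funext fun j => ?_)
          simp only [setTwo, shift]
          split_ifs <;> first | rfl | omega | skip
          obtain rfl : j = a := by omega
          exact ht
        · rfl
      simp only [h1]
      simp
    · rfl

/-- The operator acts as the identity on the coordinate `m`. -/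
structure IsLocalAt (m : ℕ) (u : Function.End ((ℕ → Fin p) → ℕ)) : Prop where
  update : ∀ f x s, u (fun y => f (Function.update y m s)) x = u f (Function.update x m s)
  restrict : ∀ f s x, u (fun y => if y m = s then f y else 0) x = if x m = s then u f x else 0

theorem isLocalAt_diapOp {k m : ℕ} (h : k + 1 < m) : IsLocalAt m (diapOp ℕ p k) where
  update f x s := by
    have e : ∀ t, setTwo (Function.update x m s) k t = Function.update (setTwo x k t) m s := by
      intro t; funext j
      simp only [setTwo, Function.update_apply]
      split_ifs <;> first | rfl | omega
    simp only [diapOp, e]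
    rw [Function.update_of_ne (by omega), Function.update_of_ne (by omega)]
  restrict f s x := by
    have e : ∀ t, setTwo x k t m = x m := by
      intro t
      rw [setTwo, if_neg (by omega)]
    simp only [diapOp, e]
    split_ifs <;> simp

theorem IsLocalAt.mul {m : ℕ} {u v : Function.End ((ℕ → Fin p) → ℕ)} (hu : IsLocalAt m u)
    (hv : IsLocalAt m v) : IsLocalAt m (u * v) where
  update f x s := by
    change u (v _) x = u (v f) _
    rw [← hu.update]
    exact congrFun (congrArg u (funext fun y => hv.update f y s)) x
  restrict f s x := by
    change u (v _) x = if _ then u (v f) x else 0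
    rw [← hu.restrict]
    exact congrFun (congrArg u (funext fun y => hv.restrict f s y)) x

theorem IsLocalAt.run {a b m : ℕ} (h : b + 1 < m) : IsLocalAt m (run (diapOp ℕ p) a b) := by
  let U : Submonoid (Function.End ((ℕ → Fin p) → ℕ)) :=
    { carrier := {u | IsLocalAt m u}
      one_mem' := ⟨fun _ _ _ => rfl, fun _ _ _ => rfl⟩
      mul_mem' := IsLocalAt.mul }
  refine U.list_prod_mem fun y hy => ?_
  obtain ⟨j, hj, rfl⟩ := List.mem_map.1 hy
  rw [List.mem_range'_1] at hj
  exact isLocalAt_diapOp (by omega)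

theorem IsJones.isLocalAt {A N m : ℕ} {L : List (ℕ × ℕ)} (hL : IsJones A N L) (h : N < m) :
    IsLocalAt m (runs (diapOp ℕ p) L) := by
  induction L generalizing A N with
  | nil => exact ⟨fun _ _ _ => rfl, fun _ _ _ => rfl⟩
  | cons x L ih =>
    rw [runs_cons]
    exact (IsLocalAt.run (by have := hL.2.2.1; omega)).mul
      (ih hL.2.2.2 (hL.2.2.1.trans h))

theorem runs_cons_apply {a b : ℕ} (hab : a ≤ b) (L : List (ℕ × ℕ)) (f : (ℕ → Fin p) → ℕ)
    (x : ℕ → Fin p) :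
    runs (diapOp ℕ p) ((a, b) :: L) f x =
      if x a = x (a + 1) then ∑ t, runs (diapOp ℕ p) L f (shift a b t x) else 0 := by
  rw [runs_cons, ← run_diapOp hab]
  rfl

/-- Undo the shift: `y` keeps the low entries of the point given by `H`, takes `z` above `a`, and
repeats `z (a + 1)` at `a` to create the required pair. -/
theorem exists_shift {a b : ℕ} {L : List (ℕ × ℕ)} (hab : a ≤ b)
    (H : ∀ z : ℕ → Fin p, ∃ y, (∀ j, a ≤ j → y j = z j) ∧ runs (diapOp ℕ p) L 1 y ≠ 0)
    (z : ℕ → Fin p) (s : Fin p) :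
    ∃ y, (∀ j, a < j → y j = z j) ∧ y a = y (a + 1) ∧
      runs (diapOp ℕ p) L 1 (shift a b s y) ≠ 0 := by
  obtain ⟨y', hy', hne⟩ := H (shift a b s z)
  refine ⟨fun j => if j < a then y' j else if j = a then z (a + 1) else z j, fun j hj => ?_, ?_, ?_⟩
  · simp only
    rw [if_neg (by omega), if_neg (by omega)]
  · simp
  · convert hne using 2
    funext j
    by_cases hj : j < a
    · simp [shift, hj]
    · rw [hy' j (by omega)]
      simp only [shift]
      split_ifs <;> first | rfl | omega

/-- Decreasing first letters mean that the equalities imposed by successive runs can be met by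
choosing ever lower entries, leaving those from `A` on free. The summand so found is not cancelled,
the values being natural numbers. -/
theorem IsJones.exists_ne_zero {A N : ℕ} {L : List (ℕ × ℕ)} (hL : IsJones A N L)
    (z : ℕ → Fin p) : ∃ y, (∀ j, A ≤ j → y j = z j) ∧ runs (diapOp ℕ p) L 1 y ≠ 0 := by
  induction L generalizing A N z with
  | nil => exact ⟨z, fun _ _ => rfl, one_ne_zero⟩
  | cons x L ih =>
    obtain ⟨a, b⟩ := x
    obtain ⟨hab, haA, hbN, hL⟩ := hL
    obtain ⟨y, hy, hya, hne⟩ := exists_shift hab (ih hL) z (z 0)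
    refine ⟨y, fun j hj => hy j (haA.trans_le hj), ?_⟩
    rw [runs_cons_apply hab, if_pos hya]
    intro h0
    exact hne (Finset.sum_eq_zero_iff.1 h0 _ (Finset.mem_univ _))

theorem runs_ne_of_last_lt (hp : 2 ≤ p) {A A' N a b k k' : ℕ} {L L' : List (ℕ × ℕ)}
    (hL : IsJones A N ((a, b) :: L)) (hL' : IsJones A' b L')
    (e : ∀ g x, p ^ k * runs (diapOp ℕ p) ((a, b) :: L) g x =
      p ^ k' * runs (diapOp ℕ p) L' g x) : False := by
  obtain ⟨hab, haA, hbN, hL⟩ := hL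
  simp only at hab haA hbN hL
  let s : Fin p := ⟨0, by omega⟩
  let r : Fin p := ⟨1, by omega⟩
  have hrs : r ≠ s := by simp [r, s]
  obtain ⟨y, hy, hya, hne⟩ := exists_shift hab hL.exists_ne_zero (fun _ => r) s
  -- The test function sees coordinate `b + 1`. The word `L'` leaves it at `r`, giving zero; the run
  -- ending in `b` can overwrite it with `s`.
  have h := e (fun y => if y (b + 1) = s then (1 : (ℕ → Fin p) → ℕ) y else 0) y
  rw [(hL'.isLocalAt (by omega)).restrict, hy _ (by omega), if_neg hrs, runs_cons_apply hab,
    if_pos hya, mul_zero, mul_eq_zero, Finset.sum_eq_zero_iff] at h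
  have h := h.resolve_left (pow_ne_zero _ (by omega)) s (Finset.mem_univ _)
  rw [(hL.isLocalAt (by omega)).restrict, if_pos] at h
  · exact hne h
  · simp only [shift]
    rw [if_neg (by omega), if_neg (by omega), if_pos le_rfl]

theorem runs_ne_of_first_lt (hp : 2 ≤ p) {A N a a' b k k' : ℕ} {L L' : List (ℕ × ℕ)}
    (hL : IsJones A N ((a, b) :: L)) (ha : a < a') (hab' : a' ≤ b)
    (e : ∀ g x, p ^ k * runs (diapOp ℕ p) ((a, b) :: L) g x =
      p ^ k' * runs (diapOp ℕ p) ((a', b) :: L') g x) : False := by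
  let s : Fin p := ⟨0, by omega⟩
  let r : Fin p := ⟨1, by omega⟩
  have hrs : r ≠ s := by simp [r, s]
  -- Lowering the bound to `a + 1` frees all coordinates above `a`, so entries `a'` and `a' + 1` may
  -- be chosen different; this kills the other word.
  have hL0 : IsJones (a + 1) N ((a, b) :: L) := ⟨hL.1, Nat.lt_succ_self a, hL.2.2⟩
  obtain ⟨y, hy, hne⟩ := hL0.exists_ne_zero (fun j => if j = a' then r else s)
  have h := e 1 y
  rw [runs_cons_apply hab', if_neg, mul_zero, mul_eq_zero] at h
  · exact h.elim (pow_ne_zero _ (by omega)) hne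
  · rw [hy _ (by omega), hy _ (by omega), if_pos rfl, if_neg (by omega)]
    exact hrs

theorem runs_cancel (a b k k' A A' : ℕ) {L L' : List (ℕ × ℕ)} (hab : a ≤ b)
    (hL : IsJones A b L) (hL' : IsJones A' b L')
    (e : ∀ g x, p ^ k * runs (diapOp ℕ p) ((a, b) :: L) g x =
      p ^ k' * runs (diapOp ℕ p) ((a, b) :: L') g x) (g : (ℕ → Fin p) → ℕ) (x : ℕ → Fin p) :
    p ^ k * runs (diapOp ℕ p) L g x = p ^ k' * runs (diapOp ℕ p) L' g x := by
  have key : ∀ g : (ℕ → Fin p) → ℕ, ∀ x, x b = x (b + 1) →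
      p ^ k * runs (diapOp ℕ p) L g x = p ^ k' * runs (diapOp ℕ p) L' g x := by
    intro g x hx
    -- The inverse shift of `x`: its pair at `b` is removed and an arbitrary pair, here of `x 0`,
    -- put at `a`. Testing coordinate `b + 1` isolates the summand t = x_b.
    let y : ℕ → Fin p := fun j => if j < a then x j else if j < a + 2 then x 0
      else if j < b + 2 then x (j - 2) else x j
    have hs : shift a b (x b) y = x := by
      funext j
      simp only [shift, y]
      split_ifs <;> first | rfl | omega | skip
      · obtain h | h : j = b ∨ j = b + 1 := by omega
        · rw [h]
        · rw [h, hx]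
    have hy : y a = y (a + 1) := by simp [y]
    have hsum : ∀ {A L}, IsJones A b L → runs (diapOp ℕ p) ((a, b) :: L)
        (fun y => if y (b + 1) = x b then g y else 0) y = runs (diapOp ℕ p) L g x := by
      intro A L hL
      rw [runs_cons_apply hab, if_pos hy, Finset.sum_eq_single (x b)]
      · rw [hs, (hL.isLocalAt (by omega)).restrict, if_pos hx.symm]
      · intro t _ ht
        rw [(hL.isLocalAt (by omega)).restrict, if_neg]
        simp only [shift]
        rw [if_neg (by omega), if_neg (by omega), if_pos le_rfl]
        exact ht
      · simp
    have h := e (fun y => if y (b + 1) = x b then g y else 0) y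
    rwa [hsum hL, hsum hL'] at h
  -- An arbitrary `x` is made to satisfy x_b = x_{b+1} by changing coordinate `b + 1`, on which both
  -- tails act as the identity; `g` restores the old value.
  have h := key (fun y => g (Function.update y (b + 1) (x (b + 1))))
    (Function.update x (b + 1) (x b)) (by simp)
  rw [(hL.isLocalAt (by omega)).update, (hL'.isLocalAt (by omega)).update] at h
  simpa using h

/-- Different Jones normal forms act differently on functions of sequences. -/
theorem IsJones.unique (hp : 2 ≤ p) {A A' N N' k k' : ℕ} {L L' : List (ℕ × ℕ)}
    (hL : IsJones A N L) (hL' : IsJones A' N' L')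
    (e : ∀ g x, p ^ k * runs (diapOp ℕ p) L g x = p ^ k' * runs (diapOp ℕ p) L' g x) :
    k = k' ∧ L = L' := by
  induction L generalizing A A' N N' L' with
  | nil =>
    rcases L' with _ | ⟨⟨a', b'⟩, L'⟩
    · have h := e 1 (fun _ => ⟨0, by omega⟩)
      simp only [runs_nil] at h
      refine ⟨Nat.pow_right_injective hp ?_, rfl⟩
      exact Nat.eq_of_mul_eq_mul_right one_pos h
    · exact (runs_ne_of_last_lt hp (A' := 0) (L' := []) hL' trivial fun g x => (e g x).symm).elim
  | cons x L ih =>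
    obtain ⟨a, b⟩ := x
    rcases L' with _ | ⟨⟨a', b'⟩, L'⟩
    · exact (runs_ne_of_last_lt hp (A' := 0) (L' := []) hL trivial e).elim
    rcases lt_trichotomy b b' with hb | rfl | hb
    · exact (runs_ne_of_last_lt hp (A' := A) (L' := (a, b) :: L) hL' ⟨hL.1, hL.2.1, hb, hL.2.2.2⟩
        fun g x => (e g x).symm).elim
    · rcases lt_trichotomy a a' with ha | rfl | ha
      · exact (runs_ne_of_first_lt hp hL ha hL'.1 e).elim
      · obtain ⟨h1, h2⟩ := ih hL.2.2.2 hL'.2.2.2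
          (runs_cancel a b k k' _ _ hL.1 hL.2.2.2 hL'.2.2.2 e)
        exact ⟨h1, by rw [h2]⟩
      · exact (runs_ne_of_first_lt hp hL' ha hL.1 fun g x => (e g x).symm).elim
    · exact (runs_ne_of_last_lt hp (A' := A') (L' := (a', b') :: L') hL
        ⟨hL'.1, hL'.2.1, hb, hL'.2.2.2⟩ e).elim

end Operators

end SelfAdjoint

/-! ### Matrices of diapsides and circles -/

namespace SelfAdjoint

universe u

section Entries

variable {R : Type u} [CommRing R]

/-- The entries of a matrix as a function on pairs of natural numbers. -/
def entries {a b : ℕ} (A : Matrix (Fin a) (Fin b) R) (i j : ℕ) : R :=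
  if h : i < a ∧ j < b then A ⟨i, h.1⟩ ⟨j, h.2⟩ else 0

theorem entries_val {a b : ℕ} (A : Matrix (Fin a) (Fin b) R) (i : Fin a) (j : Fin b) :
    entries A i j = A i j := by
  rw [entries, dif_pos ⟨i.2, j.2⟩]

theorem entries_injective {a b : ℕ} :
    Function.Injective (entries : Matrix (Fin a) (Fin b) R → ℕ → ℕ → R) := by
  intro A B h
  ext i j
  rw [← entries_val A, ← entries_val B, h]

/-- Recasting sizes does not affect entries, so matrices whose sizes agree only up to a proof can be
compared through them. -/
theorem entries_reindex {a b a' b' : ℕ} (ha : a = a') (hb : b = b')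
    (A : Matrix (Fin a) (Fin b) R) :
    entries (Matrix.reindex (finCongr ha) (finCongr hb) A) = entries A := by
  subst ha hb
  rfl

theorem entries_one (a i j : ℕ) :
    entries (1 : Matrix (Fin a) (Fin a) R) i j = if i = j ∧ i < a then 1 else 0 := by
  rw [entries]
  split_ifs with h1 h2 h2
  · rw [Matrix.one_apply, if_pos (Fin.ext h2.1)]
  · rw [Matrix.one_apply, if_neg]
    intro h
    exact h2 ⟨congrArg Fin.val h, h1.1⟩
  · omega
  · rfl

theorem entries_kron {a b c d : ℕ} (A : Matrix (Fin a) (Fin b) R) (B : Matrix (Fin c) (Fin d) R)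
    (i j : ℕ) :
    entries (kron A B) i j = entries A (i / c) (j / d) * entries B (i % c) (j % d) := by
  rcases Nat.eq_zero_or_pos c with rfl | hc
  · simp [entries]
  rcases Nat.eq_zero_or_pos d with rfl | hd
  · simp [entries]
  have h1 : i < a * c ↔ i / c < a := (Nat.div_lt_iff_lt_mul hc).symm
  have h2 : j < b * d ↔ j / d < b := (Nat.div_lt_iff_lt_mul hd).symm
  by_cases h : i < a * c ∧ j < b * d
  · rw [entries, dif_pos h, entries, dif_pos (by rwa [← h1, ← h2]), entries,
      dif_pos ⟨Nat.mod_lt _ hc, Nat.mod_lt _ hd⟩]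
    rfl
  · rw [entries, dif_neg h, entries, dif_neg (by rwa [← h1, ← h2]), zero_mul]

theorem entries_kron_one_kron (p a c : ℕ) (X : Matrix (Fin c) (Fin c) R) :
    entries (kron (1 : Matrix (Fin p) (Fin p) R) (kron (1 : Matrix (Fin a) (Fin a) R) X)) =
      entries (kron (1 : Matrix (Fin (p * a)) (Fin (p * a)) R) X) := by
  funext i j
  rw [entries_kron, entries_kron, entries_kron, entries_one, entries_one, entries_one,
    Nat.mod_mul_left_mod, Nat.mod_mul_left_mod, Nat.mod_mul_left_div_self,
    Nat.mod_mul_left_div_self, mul_comm a c, ← Nat.div_div_eq_div_mul, ← Nat.div_div_eq_div_mul,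
    ← mul_assoc, ite_zero_mul_ite_zero, mul_one]
  congr 1
  generalize i / c = u
  generalize j / c = v
  rcases Nat.eq_zero_or_pos a with rfl | ha
  · simp
  refine if_congr ?_ rfl rfl
  rw [Nat.div_lt_iff_lt_mul ha]
  have := Nat.mod_lt u ha
  constructor
  · rintro ⟨⟨h1, h2⟩, h3, -⟩
    exact ⟨by rw [← Nat.div_add_mod u a, h1, h3, Nat.div_add_mod], h2⟩
  · rintro ⟨rfl, h⟩
    exact ⟨⟨rfl, h⟩, rfl, this⟩

theorem entries_one_kron {a c : ℕ} (ha : a = 1) (X : Matrix (Fin c) (Fin c) R) :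
    entries (kron (1 : Matrix (Fin a) (Fin a) R) X) = entries X := by
  subst ha
  funext i j
  rw [entries_kron, entries_one]
  rcases Nat.eq_zero_or_pos c with rfl | hc
  · simp [entries]
  have h1 : i / c < 1 ↔ i < c := by rw [Nat.div_lt_iff_lt_mul hc, one_mul]
  have h2 : j / c < 1 ↔ j < c := by rw [Nat.div_lt_iff_lt_mul hc, one_mul]
  by_cases h : i < c ∧ j < c
  · rw [Nat.div_eq_of_lt h.1, Nat.div_eq_of_lt h.2, if_pos ⟨rfl, one_pos⟩, one_mul,
      Nat.mod_eq_of_lt h.1, Nat.mod_eq_of_lt h.2]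
  · rw [if_neg (by omega), zero_mul, entries, dif_neg h]

/-- The matrix of `H_p(f)`. -/
def HMat (R : Type u) [CommRing R] (p : ℕ) {m n : ℕ} (f : KC.Arr m n) :
    Matrix (Fin ((H R p).obj ⟨n⟩).dim) (Fin ((H R p).obj ⟨m⟩).dim) R :=
  (H R p).map f

theorem HMat_id (p n : ℕ) : HMat R p (𝟙 (KC.mk n)) = 1 := (H R p).map_id _

theorem HMat_comp (p : ℕ) {k m n : ℕ} (f : KC.Arr k m) (g : KC.Arr m n) :
    HMat R p (f ≫ g) = HMat R p g * HMat R p f := (H R p).map_comp f g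

theorem HMat_up (p : ℕ) {m n : ℕ} (f : KC.Arr m n) :
    HMat R p (KC.up f) = kron (1 : Matrix (Fin p) (Fin p) R) (HMat R p f) := by
  induction f using Quotient.inductionOn
  rfl

theorem entries_HMat_up (p : ℕ) {n : ℕ} (f : KC.Arr n n) (i j : ℕ) :
    entries (HMat R p (KC.up f)) i j =
      entries (1 : Matrix (Fin p) (Fin p) R) (i / p ^ n) (j / p ^ n) *
        entries (HMat R p f) (i % p ^ n) (j % p ^ n) := by
  rw [← H_obj_dim R p n]
  exact (congrFun (congrFun (congrArg entries (HMat_up p f)) i) j).trans (entries_kron _ _ _ _)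

theorem HMat_cap (p n : ℕ) : HMat R p (KC.cap n) = phiMat R p ((H R p).obj ⟨n⟩).dim := rfl

theorem HMat_cup (p n : ℕ) :
    HMat R p (KC.cup n) = (phiMat R p ((H R p).obj ⟨n⟩).dim).transpose := rfl

theorem entries_HMat_cap_cup (p n : ℕ) : entries (HMat R p (KC.cap n ≫ KC.cup n)) =
    entries (kron ((rowE R p).transpose * rowE R p)
      (1 : Matrix (Fin (p ^ n)) (Fin (p ^ n)) R)) := by
  rw [HMat_comp, HMat_cap, HMat_cup]
  have key : ∀ D, entries ((phiMat R p D).transpose * phiMat R p D) =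
      entries (kron ((rowE R p).transpose * rowE R p) (1 : Matrix (Fin D) (Fin D) R)) := by
    intro D
    have h : (phiMat R p D).transpose * phiMat R p D =
        Matrix.reindex (finCongr (Nat.mul_assoc p p D)) (finCongr (Nat.mul_assoc p p D))
          (kron ((rowE R p).transpose * rowE R p) (1 : Matrix (Fin D) (Fin D) R)) := by
      have h1 := kron_mul (rowE R p).transpose (rowE R p) (1 : Matrix (Fin D) (Fin D) R)
        (1 : Matrix (Fin D) (Fin D) R)
      rw [Matrix.one_mul] at h1
      rw [h1, phiMat, Matrix.transpose_reindex, kron_transpose, Matrix.transpose_one]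
      simp only [Matrix.reindex_apply, Matrix.submatrix_mul_equiv]
    rw [h, entries_reindex]
  rw [← H_obj_dim R p n]
  exact key _

/-- The topmost diapsis is φᵀφ = (EᵀE) ⊗ 1, and each further strand contributes a factor 1_p on the
left. -/
theorem entries_HMat_diap (p : ℕ) {n k : ℕ} (hk : k + 1 < n) :
    entries (HMat R p (KC.diap n k)) =
      entries (kron (1 : Matrix (Fin (p ^ (n - 2 - k))) (Fin (p ^ (n - 2 - k))) R)
        (kron ((rowE R p).transpose * rowE R p) (1 : Matrix (Fin (p ^ k)) (Fin (p ^ k)) R))) := by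
  induction n with
  | zero => omega
  | succ n ih =>
    by_cases h : k + 1 < n
    · have e : n + 1 - 2 - k = (n - 2 - k) + 1 := by omega
      rw [KC.diap_up h, e, pow_succ', ← entries_kron_one_kron]
      funext i j
      have e' : p ^ (n - 2 - k) * (p * p * p ^ k) = p ^ n := by
        exact diapsis_size p n ⟨k, by omega⟩
      rw [entries_HMat_up, ih h, entries_kron (1 : Matrix (Fin p) (Fin p) R)]
      simp only [e']
    · obtain ⟨n, rfl⟩ : ∃ m, n = m + 1 := ⟨n - 1, by omega⟩
      obtain rfl : k = n := by omega
      rw [KC.diap_top, entries_HMat_cap_cup, entries_one_kron (by simp)]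

theorem endMatrix_diap (p : ℕ) {n : ℕ} (k : Fin (n - 1)) :
    endMatrix R p n (KC.diap n k) = diapsisMatrix R p n k := by
  apply entries_injective
  rw [diapsisMatrix, entries_reindex, ← entries_HMat_diap p (by omega)]
  exact entries_reindex _ _ _

theorem endMatrix_circ (p n : ℕ) : endMatrix R p n (KC.circ n) = (p : R) • 1 := by
  have h : HMat R p (KC.circ n) = (p : R) • 1 := by
    rw [KC.circ, HMat_comp]
    exact phiMat_circle p _
  change Matrix.reindex _ _ (HMat R p (KC.circ n)) = _
  rw [h, Matrix.reindex_apply, Matrix.submatrix_smul]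
  exact congrArg (fun A => (p : R) • A)
    (Matrix.submatrix_one_equiv (α := R) (finCongr (H_obj_dim R p n)).symm)

/-- `endMatrix` as a homomorphism of monoids. -/
def endMatrixHom (R : Type u) [CommRing R] (p n : ℕ) :
    End (KC.mk n) →* Matrix (Fin (p ^ n)) (Fin (p ^ n)) R where
  toFun f := endMatrix R p n f
  map_one' := by
    change Matrix.reindex _ _ (HMat R p (𝟙 (KC.mk n))) = _
    rw [HMat_id, Matrix.reindex_apply, Matrix.submatrix_one_equiv]
  map_mul' f g := by
    change Matrix.reindex _ _ (HMat R p (g ≫ f)) =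
      Matrix.reindex _ _ (HMat R p f) * Matrix.reindex _ _ (HMat R p g)
    simp only [HMat_comp, Matrix.reindex_apply, Matrix.submatrix_mul_equiv]

/-- The homomorphism from `K_n` to the endomorphisms of `n` in `K_c`. -/
def kmonToEnd (n : ℕ) : KMon n →* End (KC.mk n) :=
  PresentedMonoid.lift (fun | .h i => KC.diap n i | .c => KC.circ n) (by
    intro a b hab
    cases hab with
    | h_comm i j hij => exact (KC.diap_comm hij (by omega)).symm
    | h_succ i j hij =>
      simp only [map_mul, FreeMonoid.lift_eval_of, hij]
      exact (KC.diap_zigzag (by omega)).1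
    | h_pred i j hij =>
      simp only [map_mul, FreeMonoid.lift_eval_of, hij]
      exact (KC.diap_zigzag (by omega)).2
    | h_circle i => exact KC.circ_comp _
    | h_sq i => exact (KC.diap_diap i (by omega)).trans (KC.circ_comp _))

theorem kmonToEnd_surjective (n : ℕ) : Function.Surjective (kmonToEnd n) := by
  intro f
  induction KC.isWord f with
  | id => exact ⟨1, map_one _⟩
  | circ f _ ih =>
    obtain ⟨x, rfl⟩ := ih
    -- Multiplication in `End` is composition in reverse, so a factor appended by `≫` appears on the
    -- left.
    exact ⟨kmonC n * x, map_mul _ _ _⟩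
  | diap f i hi _ ih =>
    obtain ⟨x, rfl⟩ := ih
    exact ⟨PresentedMonoid.of (KRel n) (.h ⟨i, by omega⟩) * x, map_mul _ _ _⟩

/-- The matrix representation of `K_n`. -/
def rep (R : Type u) [CommRing R] (p n : ℕ) : KMon n →* Matrix (Fin (p ^ n)) (Fin (p ^ n)) R :=
  (endMatrixHom R p n).comp (kmonToEnd n)

theorem rep_h (p n : ℕ) (k : Fin (n - 1)) :
    rep R p n (PresentedMonoid.of (KRel n) (.h k)) = diapsisMatrix R p n k :=
  endMatrix_diap p k

theorem rep_c (p n : ℕ) : rep R p n (PresentedMonoid.of (KRel n) .c) = (p : R) • 1 :=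
  endMatrix_circ p n

theorem range_rep (p n : ℕ) : Set.range (rep R p n) = Set.range (endMatrix R p n) :=
  (kmonToEnd_surjective n).range_comp (endMatrixHom R p n)

end Entries

/-! ### Base-p digits and the entries of a diapsis matrix -/

section Digits

theorem eq_of_digits_eq {p : ℕ} (hp : 2 ≤ p) {a b : ℕ} (h : ∀ l, a / p ^ l % p = b / p ^ l % p) :
    a = b := by
  induction a using Nat.strong_induction_on generalizing b with
  | _ a ih =>
    have h0 := h 0
    simp only [pow_zero, Nat.div_one] at h0
    have hs : ∀ l, a / p / p ^ l % p = b / p / p ^ l % p := by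
      intro l
      rw [Nat.div_div_eq_div_mul, Nat.div_div_eq_div_mul, ← pow_succ', h]
    rcases Nat.eq_zero_or_pos a with rfl | ha
    · by_contra hb
      obtain ⟨l, hl⟩ : ∃ l, b / p ^ l % p ≠ 0 := by
        by_contra! H
        exact hb (by
          have : ∀ m, p ^ m ∣ b := by
            intro m
            induction m with
            | zero => simp
            | succ m ih =>
              obtain ⟨q, rfl⟩ := ih
              have := H m
              rw [Nat.mul_div_cancel_left _ (by positivity)] at this
              rw [pow_succ]
              exact Nat.mul_dvd_mul_left _ (Nat.dvd_of_mod_eq_zero this)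
          exact (Nat.eq_zero_of_dvd_of_lt (this b) (Nat.lt_pow_self (by omega))).symm)
      exact hl (by rw [← h]; simp)
    · have h1 := ih (a / p) (Nat.div_lt_self ha (by omega)) hs
      rw [← Nat.div_add_mod a p, h1, h0, Nat.div_add_mod]

/-- This translates the two identity factors flanking EᵀE into agreement of all digits except those
at `k` and `k + 1`. -/
theorem div_eq_and_mod_eq_iff {p : ℕ} (hp : 2 ≤ p) (i j k : ℕ) :
    i / p ^ (k + 2) = j / p ^ (k + 2) ∧ i % p ^ k = j % p ^ k ↔
      ∀ l, l ≠ k → l ≠ k + 1 → i / p ^ l % p = j / p ^ l % p := by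
  have hlow : ∀ i l, l < k → i % p ^ k / p ^ l % p = i / p ^ l % p := by
    intro i l hl
    rw [← Nat.add_sub_of_le hl.le, pow_add, Nat.mod_mul_right_div_self, Nat.mod_mod_of_dvd]
    exact dvd_pow_self p (by omega)
  have hhigh : ∀ i l, i / p ^ (k + 2) / p ^ l = i / p ^ (k + 2 + l) := by
    intro i l
    rw [Nat.div_div_eq_div_mul, ← pow_add]
  constructor
  · rintro ⟨h1, h2⟩ l hl hl'
    by_cases h : l < k
    · rw [← hlow i l h, ← hlow j l h, h2]
    · obtain ⟨m, rfl⟩ : ∃ m, l = k + 2 + m := ⟨l - (k + 2), by omega⟩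
      rw [← hhigh, ← hhigh, h1]
  · intro h
    refine ⟨eq_of_digits_eq hp fun l => ?_, eq_of_digits_eq hp fun l => ?_⟩
    · rw [hhigh, hhigh, h _ (by omega) (by omega)]
    · by_cases hl : l < k
      · rw [hlow i l hl, hlow j l hl, h _ (by omega) (by omega)]
      · have : ∀ i, i % p ^ k / p ^ l = 0 := fun i => Nat.div_eq_of_lt
          ((Nat.mod_lt _ (by positivity)).trans_le (Nat.pow_le_pow_right (by omega) (by omega)))
        rw [this, this]

variable {R : Type u} [CommRing R]

theorem entries_rowE_mul (p u v : ℕ) (hu : u < p * p) (hv : v < p * p) :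
    entries ((rowE R p).transpose * rowE R p) u v =
      if u / p = u % p ∧ v / p = v % p then 1 else 0 := by
  rw [entries, dif_pos ⟨hu, hv⟩, Matrix.mul_apply]
  simp only [Finset.univ_unique, Finset.sum_singleton, Matrix.transpose_apply, rowE,
    Matrix.of_apply, ite_zero_mul_ite_zero, mul_one]
  refine if_congr (and_congr ?_ ?_) rfl rfl <;>
  · rw [Fin.ext_iff]; rfl

open scoped Classical in
theorem diapsisMatrix_apply {p : ℕ} (hp : 2 ≤ p) {n : ℕ} (k : Fin (n - 1)) (i j : Fin (p ^ n)) :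
    diapsisMatrix R p n k i j =
      if (i : ℕ) / p ^ ((k : ℕ) + 1) % p = i / p ^ (k : ℕ) % p ∧
        (j : ℕ) / p ^ ((k : ℕ) + 1) % p = j / p ^ (k : ℕ) % p ∧
        ∀ l, l ≠ (k : ℕ) → l ≠ k + 1 → (i : ℕ) / p ^ l % p = j / p ^ l % p then 1 else 0 := by
  have hpk : 0 < p ^ (k : ℕ) := by positivity
  have hd : ∀ i, i % (p * p * p ^ (k : ℕ)) / p ^ (k : ℕ) = i / p ^ (k : ℕ) % (p * p) :=
    fun i => Nat.mod_mul_left_div_self _ _ _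
  have h1 : ∀ i, i / p ^ (k : ℕ) % (p * p) / p = i / p ^ ((k : ℕ) + 1) % p := by
    intro i
    rw [Nat.mod_mul_left_div_self, Nat.div_div_eq_div_mul, pow_succ]
  have hpp : 0 < p * p := by positivity
  have e : p * p * p ^ (k : ℕ) = p ^ ((k : ℕ) + 2) := by ring
  have hlt : (i : ℕ) / p ^ ((k : ℕ) + 2) < p ^ (n - 2 - (k : ℕ)) := by
    rw [Nat.div_lt_iff_lt_mul (by positivity), ← e, diapsis_size]
    exact i.2
  rw [← entries_val (diapsisMatrix R p n k), diapsisMatrix, entries_reindex,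
    entries_kron, entries_kron, entries_one, entries_one, Nat.mod_mul_left_mod, Nat.mod_mul_left_mod, hd, hd,
    entries_rowE_mul _ _ _ (Nat.mod_lt _ hpp) (Nat.mod_lt _ hpp), h1, h1, Nat.mod_mul_left_mod,
    Nat.mod_mul_left_mod, ite_zero_mul_ite_zero, ite_zero_mul_ite_zero, mul_one, mul_one, e]
  refine if_congr ?_ rfl rfl
  rw [← div_eq_and_mod_eq_iff hp]
  have := Nat.mod_lt (i : ℕ) hpk
  tauto

end Digits

/-! ### From matrices to operators -/

section Action

variable {R : Type u} [CommRing R] {p : ℕ}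

/-- The number whose digits are the first `n` entries of a sequence. -/
def encode (n : ℕ) (x : ℕ → Fin p) : Fin (p ^ n) := finFunctionFinEquiv fun i => x i

/-- Replace the first `n` entries of a sequence by the digits of a number. -/
def decode {n : ℕ} (j : Fin (p ^ n)) (x : ℕ → Fin p) : ℕ → Fin p :=
  fun m => if h : m < n then finFunctionFinEquiv.symm j ⟨m, h⟩ else x m

theorem encode_decode {n : ℕ} (j : Fin (p ^ n)) (x : ℕ → Fin p) : encode n (decode j x) = j := by
  simp [encode, decode]

theorem decode_decode {n : ℕ} (i j : Fin (p ^ n)) (x : ℕ → Fin p) :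
    decode i (decode j x) = decode i x := by
  funext m
  simp only [decode]
  split_ifs <;> rfl

theorem decode_encode (n : ℕ) (x : ℕ → Fin p) : decode (encode n x) x = x := by
  funext m
  simp [decode, encode]

theorem encode_div_mod {n l : ℕ} (hl : l < n) (x : ℕ → Fin p) :
    (encode n x : ℕ) / p ^ l % p = x l := by
  have h : finFunctionFinEquiv.symm (encode n x) ⟨l, hl⟩ = x l := by simp [encode]
  rw [← h]
  rfl

/-- The action of matrices on functions of sequences through the first `n` entries. -/
def matAction (R : Type u) [CommRing R] (p n : ℕ) :
    Matrix (Fin (p ^ n)) (Fin (p ^ n)) R →* Function.End ((ℕ → Fin p) → R) where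
  toFun A := fun f x => ∑ j, A (encode n x) j * f (decode j x)
  map_one' := by
    funext f x
    simp only [Matrix.one_apply, ite_mul, one_mul, zero_mul, Finset.sum_ite_eq, Finset.mem_univ,
      if_true, decode_encode]
    rfl
  map_mul' A B := by
    funext f x
    change _ = ∑ l, A (encode n x) l *
      ∑ j, B (encode n (decode l x)) j * f (decode j (decode l x))
    simp only [encode_decode, decode_decode, Matrix.mul_apply, Finset.sum_mul, Finset.mul_sum,
      mul_assoc]
    exact Finset.sum_comm

theorem matAction_smul_one (n : ℕ) (r : R) (f : (ℕ → Fin p) → R) (x : ℕ → Fin p) :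
    matAction R p n (r • 1) f x = r * f x := by
  change ∑ j, (r • (1 : Matrix (Fin (p ^ n)) (Fin (p ^ n)) R)) (encode n x) j * f (decode j x) = _
  simp [Matrix.one_apply, decode_encode]

-- Row x of the matrix vanishes unless x_k = x_{k+1}; then its ones stand in the columns of the
-- sequences got from x by replacing that pair.
open scoped Classical in
theorem matAction_diapsisMatrix (hp : 2 ≤ p) {n : ℕ} (k : Fin (n - 1)) :
    matAction R p n (diapsisMatrix R p n k) = diapOp R p k := by
  funext f x
  have hk : (k : ℕ) + 1 < n := by omega
  change ∑ j, diapsisMatrix R p n k (encode n x) j * f (decode j x) = _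
  have hD : ∀ j : Fin (p ^ n), diapsisMatrix R p n k (encode n x) j =
      if x k = x (k + 1) ∧ ∃ t, decode j x = setTwo x k t then 1 else 0 := by
    intro j
    rw [diapsisMatrix_apply hp]
    refine if_congr ?_ rfl rfl
    have hj := encode_decode j x
    have hyn : ∀ l, n ≤ l → decode j x l = x l := by
      intro l hl
      rw [decode, dif_neg (by omega)]
    generalize decode j x = y at hj hyn
    subst hj
    rw [encode_div_mod hk, encode_div_mod (by omega), encode_div_mod hk,
      encode_div_mod (by omega), ← Fin.ext_iff, ← Fin.ext_iff, @eq_comm _ (x (k + 1))]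
    refine and_congr_right fun _ => ?_
    constructor
    · rintro ⟨h1, h2⟩
      refine ⟨y k, funext fun l => ?_⟩
      rw [setTwo]
      split_ifs with hl
      · rcases hl with rfl | rfl
        · rfl
        · exact h1
      · rcases lt_or_ge l n with hln | hln
        · have := h2 l (by omega) (by omega)
          rw [encode_div_mod hln, encode_div_mod hln] at this
          exact (Fin.ext this).symm
        · exact hyn l hln
    · rintro ⟨t, rfl⟩
      refine ⟨by simp [setTwo], fun l h1 h2 => ?_⟩
      rcases lt_or_ge l n with hln | hln
      · rw [encode_div_mod hln, encode_div_mod hln, setTwo, if_neg (by omega)]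
      · have : ∀ i : Fin (p ^ n), (i : ℕ) / p ^ l = 0 := fun i => Nat.div_eq_of_lt
          (i.2.trans_le (Nat.pow_le_pow_right (by omega) hln))
        rw [this, this]
  simp only [hD, diapOp]
  split_ifs with hx
  · simp only [hx, true_and, ite_mul, one_mul, zero_mul]
    rw [← Finset.sum_filter]
    symm
    have hdec : ∀ t, decode (encode n (setTwo x k t)) x = setTwo x k t := by
      intro t
      funext m
      simp only [decode, encode, Equiv.symm_apply_apply]
      split_ifs with h
      · rfl
      · rw [setTwo, if_neg (by omega)]
    refine Finset.sum_bij (fun t _ => encode n (setTwo x k t)) ?_ ?_ ?_ ?_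
    · intro t _
      simp only [Finset.mem_filter, Finset.mem_univ, true_and]
      exact ⟨t, hdec t⟩
    · intro t _ t' _ h
      have := (hdec t).symm.trans ((congrArg (decode · x) h).trans (hdec t'))
      simpa [setTwo] using congrFun this k
    · intro j hj
      obtain ⟨t, ht⟩ := (Finset.mem_filter.1 hj).2
      exact ⟨t, Finset.mem_univ _, by rw [← ht, encode_decode]⟩
    · intro t _
      rw [hdec]
  · simp [hx]

end Action

/-! ### Injectivity of the representation of K_n -/

section Injectivity

/-- The letters of a list of runs. -/
def letters (L : List (ℕ × ℕ)) : List ℕ := L.flatMap fun x => List.range' x.1 (x.2 + 1 - x.1)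

theorem runs_eq_prod {M : Type*} [Monoid M] (h : ℕ → M) (L : List (ℕ × ℕ)) :
    runs h L = ((letters L).map h).prod := by
  induction L with
  | nil => rfl
  | cons x L ih => simp [letters, run, ih]

theorem IsJones.lt_of_mem_letters {A N : ℕ} {L : List (ℕ × ℕ)} (hL : IsJones A N L) {i : ℕ}
    (hi : i ∈ letters L) : i < N := by
  induction L generalizing A N with
  | nil => simp [letters] at hi
  | cons x L ih =>
    have := hL.2.2.1
    rw [letters, List.flatMap_cons, List.mem_append, List.mem_range'_1] at hi
    rcases hi with hi | hi
    · omega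
    · exact (ih hL.2.2.2 hi).trans this

/-- The operators have natural coefficients, so comparison of words may take place over `ℕ`, where a
sum vanishes only termwise. -/
theorem runs_diapOp_cast (S : Type*) [Semiring S] (p : ℕ) (L : List (ℕ × ℕ))
    (g : (ℕ → Fin p) → ℕ) (x : ℕ → Fin p) :
    runs (diapOp S p) L (fun y => (g y : S)) x = (runs (diapOp ℕ p) L g x : S) := by
  rw [runs_eq_prod, runs_eq_prod]
  generalize letters L = l
  induction l generalizing x with
  | nil => rfl
  | cons i l ih =>
    simp only [List.map_cons, List.prod_cons]
    change diapOp S p i (_) x = ((diapOp ℕ p i (_) x : ℕ) : S)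
    simp only [diapOp, ih]
    split_ifs <;> simp

variable {R : Type u} [CommRing R]

theorem matAction_rep_apply {p : ℕ} (hp : 2 ≤ p) (n k : ℕ) {L : List (ℕ × ℕ)}
    (hL : IsJones (n - 1) (n - 1) L) (g : (ℕ → Fin p) → ℕ) (x : ℕ → Fin p) :
    matAction R p n (rep R p n (kmonC n ^ k * runs (kmonH n) L)) (fun y => (g y : R)) x =
      ((p ^ k * runs (diapOp ℕ p) L g x : ℕ) : R) := by
  have hc : rep R p n (kmonC n ^ k) = ((p : R) ^ k) • 1 := by
    rw [map_pow, kmonC, rep_c, smul_pow, one_pow]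
  have hr : matAction R p n (rep R p n (runs (kmonH n) L)) = runs (diapOp R p) L := by
    rw [runs_eq_prod, runs_eq_prod, map_list_prod, map_list_prod, List.map_map, List.map_map]
    congr 1
    refine List.map_congr_left fun i hi => ?_
    have hi' := hL.lt_of_mem_letters hi
    simp only [Function.comp_apply]
    rw [kmonH, dif_pos hi', rep_h, matAction_diapsisMatrix hp]
  rw [map_mul, map_mul, hr, hc]
  change matAction R p n _ (runs (diapOp R p) L _) x = _
  rw [matAction_smul_one, runs_diapOp_cast]
  push_cast
  rfl

theorem rep_injective [CharZero R] {p : ℕ} (hp : 2 ≤ p) (n : ℕ) :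
    Function.Injective (rep R p n) := by
  intro x y h
  obtain ⟨k, L, hL, rfl⟩ := exists_jones n x
  obtain ⟨k', L', hL', rfl⟩ := exists_jones n y
  obtain ⟨rfl, rfl⟩ := hL.unique hp hL' (k := k) (k' := k') fun g z => by
    have h1 := matAction_rep_apply (R := R) hp n k hL g z
    rw [h, matAction_rep_apply hp n k' hL' g z] at h1
    exact_mod_cast h1.symm
  rfl

theorem endMatrix_injective [CharZero R] {p : ℕ} (hp : 2 ≤ p) (n : ℕ) :
    Function.Injective (endMatrix R p n) := by
  intro f g h
  obtain ⟨x, rfl⟩ := kmonToEnd_surjective n f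
  obtain ⟨y, rfl⟩ := kmonToEnd_surjective n g
  exact congrArg _ (rep_injective (R := R) hp n h)

end Injectivity

end SelfAdjoint

namespace SelfAdjoint

universe u

/-! ### Bending strands: from endomorphisms to all arrows -/

section Faithful

variable {R : Type u} [CommRing R]

/-- The functor `H_p` is injective on the arrows from `m` to `n`. -/
def FaithfulAt (R : Type u) [CommRing R] (p m n : ℕ) : Prop :=
  Function.Injective fun f : KC.Arr m n => HMat R p f

theorem faithfulAt_self [CharZero R] {p : ℕ} (hp : 2 ≤ p) (n : ℕ) : FaithfulAt R p n n :=
  fun _ _ h => endMatrix_injective hp n (congrArg (Matrix.reindex _ _) h)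

/-- Transposition along the self-adjunction is undone by a triangle identity, and H_p of the
transpose of f depends only on H_p(f). -/
theorem FaithfulAt.bend {p m n : ℕ} (h : FaithfulAt R p (m + 1) n) : FaithfulAt R p m (n + 1) := by
  have key : ∀ f : KC.Arr m (n + 1), KC.cup m ≫ KC.up (KC.up f ≫ KC.cap n) = f := by
    intro f
    rw [KC.up_comp, KC.cup_up_up_assoc, KC.cup_up_cap, Category.comp_id]
  intro f g hfg
  have e : KC.up f ≫ KC.cap n = KC.up g ≫ KC.cap n := by
    apply h
    simp only at hfg ⊢
    rw [HMat_comp, HMat_comp, HMat_up, HMat_up, hfg]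
  rw [← key f, ← key g, e]

theorem FaithfulAt.unbend {p m n : ℕ} (h : FaithfulAt R p m (n + 1)) :
    FaithfulAt R p (m + 1) n := by
  have key : ∀ f : KC.Arr (m + 1) n, KC.up (KC.cup m ≫ KC.up f) ≫ KC.cap n = f := by
    intro f
    rw [KC.up_comp, Category.assoc, KC.up_up_cap, KC.up_cup_cap_assoc]
  intro f g hfg
  have e : KC.cup m ≫ KC.up f = KC.cup m ≫ KC.up g := by
    apply h
    simp only at hfg ⊢
    rw [HMat_comp, HMat_comp, HMat_up, HMat_up, hfg]
  rw [← key f, ← key g, e]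

/-- Parity leaves no arrows m → n with m + n odd, so bending from the diagonal reaches every
inhabited type. -/
theorem ArrowTerm.even_add {m n : ℕ} (f : ArrowTerm m n) : Even (m + n) := by
  induction f with
  | one n => exact ⟨n, rfl⟩
  | phi n => exact ⟨n + 1, by ring⟩
  | gam n => exact ⟨n + 1, by ring⟩
  | F f ih => grind
  | comp g f ihg ihf => grind

theorem faithfulAt_of_add_eq [CharZero R] {p : ℕ} (hp : 2 ≤ p) {N m n : ℕ} (h : m + n = N + N) :
    FaithfulAt R p m n := by
  rcases le_total m n with hmn | hmn
  · obtain ⟨d, rfl⟩ : ∃ d, N = m + d := ⟨N - m, by omega⟩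
    obtain rfl : n = m + d + d := by omega
    -- Start at endomorphisms of N = m + d and move `d'` strands from source to target.
    have : ∀ d' ≤ d, FaithfulAt R p (m + d - d') (m + d + d') := by
      intro d'
      induction d' with
      | zero => exact fun _ => faithfulAt_self hp _
      | succ d' ih =>
        intro hd
        refine FaithfulAt.bend ?_
        rw [show m + d - (d' + 1) + 1 = m + d - d' by omega]
        exact ih (by omega)
    simpa using this d le_rfl
  · obtain ⟨d, rfl⟩ : ∃ d, N = n + d := ⟨N - n, by omega⟩
    obtain rfl : m = n + d + d := by omega
    have : ∀ d' ≤ d, FaithfulAt R p (n + d + d') (n + d - d') := by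
      intro d'
      induction d' with
      | zero => exact fun _ => faithfulAt_self hp _
      | succ d' ih =>
        intro hd
        refine FaithfulAt.unbend (m := n + d + d') ?_
        rw [show n + d - (d' + 1) + 1 = n + d - d' by omega]
        exact ih (by omega)
    simpa using this d le_rfl

theorem faithfulAt [CharZero R] {p : ℕ} (hp : 2 ≤ p) (m n : ℕ) : FaithfulAt R p m n := by
  intro f g hfg
  obtain ⟨t, ht⟩ := Quotient.exists_rep f
  obtain ⟨N, hN⟩ := t.even_add
  exact faithfulAt_of_add_eq hp hN hfg

theorem H_map_injective [CharZero R] {p : ℕ} (hp : 2 ≤ p) (a b : KC) :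
    Function.Injective fun f : a ⟶ b => (H R p).map f :=
  faithfulAt hp a.deg b.deg

theorem H_obj_injective {p : ℕ} (hp : 2 ≤ p) : Function.Injective (H R p).obj := by
  rintro ⟨m⟩ ⟨n⟩ h
  have := congrArg MatCat.dim h
  rw [H_obj_dim, H_obj_dim] at this
  rw [Nat.pow_right_injective hp this]

end Faithful

/-! ### Injective functors and their images -/

section Subcategories

variable {C : Type*} [Category* C] {D : Type*} [Category* D]

/-- An object of the arrow category is an arrow together with its type, so this is injectivity on
arrows of arbitrary types. -/
theorem mapArrow_obj_injective {G : C ⥤ D} (hobj : Function.Injective G.obj)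
    (hmap : ∀ a b : C, Function.Injective fun f : a ⟶ b => G.map f) :
    Function.Injective G.mapArrow.obj := by
  rintro ⟨a, b, f⟩ ⟨a', b', f'⟩ h
  obtain rfl : a = a' := hobj (congrArg Comma.left h)
  obtain rfl : b = b' := hobj (congrArg Comma.right h)
  obtain rfl : f = f' := hmap _ _ (Arrow.mk_injective _ _ h)
  rfl

end Subcategories

universe v w

/-- The image of a functor that is injective on objects. -/
def Subcat.image {C : Type w} [Category.{v} C] {D : Type u} [Category.{v} D] (G : C ⥤ D)
    (hG : Function.Injective G.obj) : Subcat D where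
  objs := Set.range G.obj
  homs X Y := {g | ∃ (a b : C) (f : a ⟶ b), Arrow.mk g = Arrow.mk (G.map f)}
  id_mem := by
    rintro _ ⟨a, rfl⟩
    exact ⟨a, a, 𝟙 a, by rw [G.map_id]⟩
  comp_mem := by
    rintro X Y Z f g - - - ⟨a, b, f', hf⟩ ⟨b', c, g', hg⟩
    obtain rfl : X = G.obj a := congrArg Comma.left hf
    obtain rfl : Y = G.obj b := congrArg Comma.right hf
    obtain rfl : Z = G.obj c := congrArg Comma.right hg
    -- Injectivity on objects makes composable arrows of the image come from composable arrows;
    -- otherwise the image need not be closed under composition.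
    obtain rfl : b = b' := hG (congrArg Comma.left hg)
    obtain rfl : f = G.map f' := Arrow.mk_injective _ _ hf
    obtain rfl : g = G.map g' := Arrow.mk_injective _ _ hg
    exact ⟨a, c, f' ≫ g', by rw [G.map_comp]⟩

/-- The corestriction of a functor to its image. -/
def Subcat.toImage {C : Type w} [Category.{v} C] {D : Type u} [Category.{v} D] (G : C ⥤ D)
    (hG : Function.Injective G.obj) : C ⥤ (Subcat.image G hG).Obj where
  obj a := ⟨G.obj a, a, rfl⟩
  map f := ⟨G.map f, _, _, f, rfl⟩
  map_id a := Subtype.ext (G.map_id a)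
  map_comp f g := Subtype.ext (G.map_comp f g)

theorem Subcat.isCategoryIso_toImage {C : Type w} [Category.{v} C] {D : Type u} [Category.{v} D]
    (G : C ⥤ D) (hG : Function.Injective G.obj)
    (hmap : ∀ a b : C, Function.Injective fun f : a ⟶ b => G.map f) :
    IsCategoryIso (Subcat.toImage G hG) := by
  refine ⟨⟨fun a b h => hG (congrArg Subcat.Obj.val h), ?_⟩, fun a b => ⟨fun f g h => ?_, ?_⟩⟩
  · rintro ⟨_, a, rfl⟩
    exact ⟨a, rfl⟩
  · exact hmap _ _ (congrArg Subtype.val h)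
  · rintro ⟨g, a', b', f, h⟩
    obtain rfl : a = a' := hG (congrArg Comma.left h)
    obtain rfl : b = b' := hG (congrArg Comma.right h)
    refine ⟨f, Subtype.ext ?_⟩
    exact (Arrow.mk_injective _ _ h : g = G.map f).symm

end SelfAdjoint

theorem mainTheorem1 (𝓕 : Subfield ℂ) (p : ℕ) (hp : 2 ≤ p) :
    (∀ (m n : ℕ) (f g : SelfAdjoint.ArrowTerm m n),
      (SelfAdjoint.H 𝓕 p).map (SelfAdjoint.KC.arrow f) =
        (SelfAdjoint.H 𝓕 p).map (SelfAdjoint.KC.arrow g) → SelfAdjoint.KEq f g) ∧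
    Function.Injective (SelfAdjoint.H 𝓕 p).obj ∧
    Function.Injective (SelfAdjoint.H 𝓕 p).mapArrow.obj ∧
    (∃ (S : SelfAdjoint.Subcat (SelfAdjoint.MatCat 𝓕)) (G : CategoryTheory.Functor SelfAdjoint.KC S.Obj),
      SelfAdjoint.IsCategoryIso G ∧ G.comp S.incl = SelfAdjoint.H 𝓕 p) ∧
    (∀ n : ℕ, ∃ ρ : SelfAdjoint.KMon n →* Matrix (Fin (p ^ n)) (Fin (p ^ n)) 𝓕,
      (∀ k : Fin (n - 1), ρ (PresentedMonoid.of (SelfAdjoint.KRel n) (.h k)) =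
        SelfAdjoint.diapsisMatrix 𝓕 p n k) ∧
      ρ (PresentedMonoid.of (SelfAdjoint.KRel n) .c) = (p : 𝓕) • 1 ∧
      Function.Injective ρ ∧
      Set.range ρ = Set.range (SelfAdjoint.endMatrix 𝓕 p n)) := by
  have hobj := SelfAdjoint.H_obj_injective (R := 𝓕) hp
  refine ⟨fun m n f g h => Quotient.exact (SelfAdjoint.H_map_injective hp _ _ h), hobj,
    SelfAdjoint.mapArrow_obj_injective hobj (SelfAdjoint.H_map_injective hp),
    ⟨_, SelfAdjoint.Subcat.toImage (SelfAdjoint.H 𝓕 p) hobj,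
      SelfAdjoint.Subcat.isCategoryIso_toImage _ hobj (SelfAdjoint.H_map_injective hp), rfl⟩,
    fun n => ⟨SelfAdjoint.rep 𝓕 p n, SelfAdjoint.rep_h p n, SelfAdjoint.rep_c p n,
      SelfAdjoint.rep_injective hp n, SelfAdjoint.range_rep p n⟩⟩
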